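/- Let $\|\cdot\|$ be an arbitrary norm on $\mathbb R^d$ with dual norm $\|u\|_*=\sup_{\|v\|\le 1}\langle u,v\rangle$, and let $\underline\rho,\bar\rho>0$ satisfy $\underline\rho\|v\|_2\le\|v\|_*\le\bar\rho\|v\|_2$ for all $v$. Let $f(x)=\mathbb E_{\xi\sim\mathcal D}[f_\xi(x)]$, where every $f_\xi$ is continuously differentiable. Let $\sigma_g,L_0,L_1,\mathcal L_0,\mathcal L_1\ge 0$ with $L_1,\mathcal L_1$ not both zero, and suppose that for all $x,y\in\mathbb R^d$: (i) $\mathbb E_\xi[\nabla f_\xi(x)]=\nabla f(x)$ and $\mathbb E_\xi\|\nabla f_\xi(x)-\nabla f(x)\|_2^2\le\sigma_g^2$; (ii) $f_{\inf}=\inf_x f(x)>-\infty$; (iii) $f$ is differentiable and $\|\nabla f(x)-\nabla f(y)\|_*\le\big(L_0+L_1\sup_{\theta\in[0,1]}\|\nabla f(\theta x+(1-\theta)y)\|_*\big)\|x-y\|$; (iv) $\mathbb E_\xi\|\nabla f_\xi(x)-\nabla f_\xi(y)\|_*^2\le\mathbb E_\xi\big(\mathcal L_0+\mathcal L_1\sup_{\theta\in[0,1]}\|\nabla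 f_\xi(\theta x+(1-\theta)y)\|_*\big)^2\,\|x-y\|^2$, the expectation on the right being finite. Let $K\in\mathbb N$ and set $$\alpha_k=\alpha=\frac1{(K+1)^{2/3}},\qquad \beta_k=1-\alpha_k,\qquad \eta_k=\eta=\frac{\hat\eta}{(K+1)^{2/3}},\qquad \hat\eta=\frac13\min\Big\{\frac1{L_1},\ \frac1{11\mathcal L_1}\Big(\frac{\bar\rho}{\underline\rho}\Big)^{-1}\Big\}$$ (with $1/0=+\infty$). Given a deterministic $x_0$ and a possibly random $m_0$ with $\mathbb E\|m_0\|<\infty$, let $$x_{k+1}=x_k+\mathrm{lmo}(m_k),\qquad \mathrm{lmo}(m_k)\in\operatorname*{argmin}_{\|v\|\le\eta_k}\langle m_k,v\rangle,$$ $$m_{k+1}=(1-\alpha_k)\Big(m_k+\frac{\beta_k}{1-\alpha_k}\big[\nabla f_{\xi_{k+1}}(x_{k+1})-\nabla f_{\xi_{k+1}}(x_k)\big]\Big)+\alpha_k\nabla f_{\xi_{k+1}}(z_{k+1}),$$ where either $z_{k+1}=x_{k+1}$ for all $k$ (the usual STORM recursion) or $z_{k+1}=x_k$ for all $k$, the sample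 $\xi_{k+1}\sim\mathcal D$ is independent of $m_0,\xi_1,\dots,\xi_k$ and of the choices of minimizers made so far, and $x_{k+1}$ depends only on this past. Put $e_0=m_0-\nabla f(x_0)$. Then the expectations below are finite and $$\min_{0\le k\le K}\mathbb E\|\nabla f(x_k)\|_*\le\frac{2(f(x_0)-f_{\inf})}{\hat\eta(K+1)^{1/3}}+\frac{4\big(\mathbb E\|e_0\|_*+\bar\rho\,\sigma_g\big)}{(K+1)^{1/3}}+\frac{\hat\eta L_0\exp(L_1\hat\eta)}{(K+1)^{2/3}}+8\,\frac{\bar\rho}{\underline\rho}\,\big(\mathcal L_0+2\mathcal L_1\bar\rho\,\sigma_g\big)\exp\big(6\mathcal L_1^2\hat\eta^2\big)\frac{\hat\eta}{(K+1)^{1/3}}.$$ In particular the minimum is $O(K^{-1/3})$. -/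

import Mathlib

open MeasureTheory ProbabilityTheory
open scoped ENNReal

/-- `d`-dimensional Euclidean space; its built-in norm `‖·‖` is the Euclidean norm. -/
abbrev Vec (d : ℕ) : Type := EuclideanSpace ℝ (Fin d)

/-- The dual norm `‖u‖_* = sup {⟨u, v⟩ : N v ≤ 1}` of a norm `N` on `ℝ^d`. -/
noncomputable def dualNorm {d : ℕ} (N : Seminorm ℝ (Vec d)) (u : Vec d) : ℝ :=
  sSup ((fun v : Vec d => inner ℝ u v) '' {v | N v ≤ 1})

/-- `v ∈ argmin {⟨m, w⟩ : N w ≤ r}`: `v` is a possible output of the linear minimization oracle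
over the ball of radius `r` of the norm `N`. -/
def IsLMO {d : ℕ} (N : Seminorm ℝ (Vec d)) (r : ℝ) (m v : Vec d) : Prop :=
  N v ≤ r ∧ ∀ w : Vec d, N w ≤ r → (inner ℝ m v : ℝ) ≤ inner ℝ m w

/-- The objective `f(x) = E_ξ[f_ξ(x)]`. -/
noncomputable def objective {d : ℕ} {Ξ : Type*} [MeasurableSpace Ξ] (D : Measure Ξ)
    (F : Ξ → Vec d → ℝ) (x : Vec d) : ℝ :=
  ∫ s, F s x ∂D

/-- `sup_{θ ∈ [0,1]} ‖G(θ x + (1-θ) y)‖_*`, as an extended nonnegative number. -/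
noncomputable def segmentSup {d : ℕ} (N : Seminorm ℝ (Vec d)) (G : Vec d → Vec d)
    (x y : Vec d) : ℝ≥0∞ :=
  ⨆ θ ∈ Set.Icc (0 : ℝ) 1, ENNReal.ofReal (dualNorm N (G (θ • x + (1 - θ) • y)))

/-- The stochastic gradients `∇f_ξ(x)` are unbiased estimators of `∇f(x)` with variance, measured
in the Euclidean norm, at most `σ²`. -/
def UnbiasedBoundedVariance {d : ℕ} {Ξ : Type*} [MeasurableSpace Ξ] (D : Measure Ξ)
    (F : Ξ → Vec d → ℝ) (σ : ℝ) : Prop :=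
  ∀ x : Vec d,
    Integrable (fun s => gradient (F s) x) D ∧
    ∫ s, gradient (F s) x ∂D = gradient (objective D F) x ∧
    Integrable (fun s => ‖gradient (F s) x - gradient (objective D F) x‖ ^ 2) D ∧
    ∫ s, ‖gradient (F s) x - gradient (objective D F) x‖ ^ 2 ∂D ≤ σ ^ 2

/-- `f` is differentiable and its gradient is symmetrically `(L₀, L₁)`-Lipschitz continuous with
respect to the norm `N`. -/
def RelaxedSmooth {d : ℕ} (N : Seminorm ℝ (Vec d)) (L₀ L₁ : ℝ) (f : Vec d → ℝ) : Prop :=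
  Differentiable ℝ f ∧
  ∀ x y : Vec d,
    ENNReal.ofReal (dualNorm N (gradient f x - gradient f y)) ≤
      (ENNReal.ofReal L₀ + ENNReal.ofReal L₁ * segmentSup N (gradient f) x y) *
        ENNReal.ofReal (N (x - y))

/-- The stochastic gradients are mean-squared symmetrically `(ℒ₀, ℒ₁)`-Lipschitz continuous with
respect to the norm `N`; the expectation on the right-hand side is a (finite) real number. -/
def MeanSquaredRelaxedSmooth {d : ℕ} {Ξ : Type*} [MeasurableSpace Ξ] (D : Measure Ξ)
    (N : Seminorm ℝ (Vec d)) (ℒ₀ ℒ₁ : ℝ) (F : Ξ → Vec d → ℝ) : Prop :=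
  ∀ x y : Vec d,
    (∫⁻ s, (ENNReal.ofReal ℒ₀ + ENNReal.ofReal ℒ₁ * segmentSup N (gradient (F s)) x y) ^ 2 ∂D)
      < ∞ ∧
    (∫⁻ s, ENNReal.ofReal (dualNorm N (gradient (F s) x - gradient (F s) y)) ^ 2 ∂D) ≤
      (∫⁻ s, (ENNReal.ofReal ℒ₀ + ENNReal.ofReal ℒ₁ * segmentSup N (gradient (F s)) x y) ^ 2 ∂D)
        * ENNReal.ofReal (N (x - y)) ^ 2

/-- `(x_k), (m_k)` are generated by the LMO-based method with momentum variance reduction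
(MARS; STORM when `β_k = 1 - α_k`) with stepsizes `η_k`, momentum parameters `α_k` and scaling
factors `β_k`, started at the deterministic point `x₀` and at a possibly random integrable `m_0`.
The filtration `ℱ` records the information available: `ℱ k` contains `m_0` and the samples
`ξ_1, …, ξ_k`; a fresh sample `ξ_{k+1} ∼ D` is independent of `ℱ k`; the minimizer returned by the
oracle at step `k` (which need not be unique) is chosen using the information in `ℱ k` only.
The two variants of the momentum update found in the literature are selected by `atNew`: the
plain stochastic gradient term is evaluated at the new point `x_{k+1}` (`atNew = true`, the usual
STORM recursion) or at the old point `x_k` (`atNew = false`). -/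
structure IsLMOMars {d : ℕ} {Ξ Ω : Type*} [MeasurableSpace Ξ] [mΩ : MeasurableSpace Ω]
    (P : Measure Ω) (D : Measure Ξ) (N : Seminorm ℝ (Vec d)) (F : Ξ → Vec d → ℝ)
    (α β η : ℕ → ℝ) (atNew : Bool) (x₀ : Vec d) (ℱ : Filtration ℕ mΩ) (ξ : ℕ → Ω → Ξ)
    (x m : ℕ → Ω → Vec d) : Prop where
  sample_measurable : ∀ k, Measurable[ℱ (k + 1)] (ξ (k + 1))
  sample_law : ∀ k, P.map (ξ (k + 1)) = D
  sample_indep : ∀ k, Indep (MeasurableSpace.comap (ξ (k + 1)) inferInstance) (ℱ k) P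
  x_zero : ∀ ω, x 0 ω = x₀
  m_zero_measurable : Measurable[ℱ 0] (m 0)
  m_zero_integrable : Integrable (m 0) P
  x_measurable : ∀ k, Measurable[ℱ k] (x (k + 1))
  x_step : ∀ k ω, IsLMO N (η k) (m k ω) (x (k + 1) ω - x k ω)
  m_step : ∀ k ω, m (k + 1) ω =
    (1 - α k) • (m k ω + (β k / (1 - α k)) •
      (gradient (F (ξ (k + 1) ω)) (x (k + 1) ω) - gradient (F (ξ (k + 1) ω)) (x k ω)))
    + α k • gradient (F (ξ (k + 1) ω)) (if atNew then x (k + 1) ω else x k ω)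

/-- `η̂ = (1/3) min {1/L₁, (1/(11 ℒ₁)) (ρ̄/ρ̲)⁻¹}`, where `1/0` is read as `+∞` (so a term whose
denominator vanishes is dropped from the minimum; used only when `L₁`, `ℒ₁` are not both `0`). -/
noncomputable def stepScale (L₁ ℒ₁ ρlo ρhi : ℝ) : ℝ :=
  if L₁ = 0 then 1 / 3 * (1 / (11 * ℒ₁) * (ρhi / ρlo)⁻¹)
  else if ℒ₁ = 0 then 1 / 3 * (1 / L₁)
  else 1 / 3 * min (1 / L₁) (1 / (11 * ℒ₁) * (ρhi / ρlo)⁻¹)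

/-!
The argument runs in three stages. Throughout, `‖·‖_*` is the dual norm, `g = ∇f`,
`e_k = m_k - g(x_k)`, `κ = ρhi / ρlo` and `a = ℒ₀ + ℒ₁ ρhi σ`.

*Asymmetric smoothness.* The relaxed smoothness hypotheses bound an increment of the gradient by a
supremum over the whole segment. Along a segment, dominated convergence turns them into a
differential inequality in `L²(D)`, and Grönwall's inequality (`eLpNorm_curve_le`) gives
`‖∇f_ξ(y) - ∇f_ξ(x)‖_{L²} ≤ (a + ℒ₁ ‖g(x)‖_*) r exp(ℒ₁ r)` in the dual norm, with `r = N (y - x)`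
(`MeanSquaredRelaxedSmooth.eLpNorm_increment_le`). A one-point probability space yields the
analogue for `g` itself (`RelaxedSmooth.sub_le`). The suprema in the hypothesis on `f` are finite
because the mean-squared hypothesis makes `g` Lipschitz along segments.

*Momentum error.* The recursion reads
`e_{k+1} = (1 - α) e_k + (1 - α) Δ + α n + α b`, with `Δ` the centred gradient increment, `n` the
centred gradient noise and `b` a drift which vanishes for the usual STORM recursion and otherwise is
a mean gradient increment. The conditional second mean of `Δ` grows with `‖g(x_k)‖_*`, of which only
first moments are under control, so `Δ` is split by a predictable weight into a part with
conditionally bounded second mean, averaged by orthogonality with a gain `√α`, and a part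
proportional to `ℒ₁ ‖g(x_k)‖_*`, handled by the triangle inequality
(`sum_integral_momentum_error_le`). The second part costs `κ ℒ₁ (η / α) ∑ E ‖g(x_k)‖_*` up to a
constant; as `η / α = ηhat`, the choice of `ηhat` lets the left-hand side absorb it.

*Descent.* The oracle attains `-η ‖m_k‖_*`, whence
`η (1 - L₁ η exp(L₁ η) / 2) ‖g(x_k)‖_* ≤ f(x_k) - f(x_{k+1}) + 2 η ‖e_k‖_* + L₀ exp(L₁ η) η² / 2`
(`IsLMO.descent`). Summing over `k`, taking expectations and inserting the error bound leaves a
numerical balance (`average_le_of_descent`).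
-/

/-! ### The dual norm and the oracle -/

section DualNorm

variable {d : ℕ} {N : Seminorm ℝ (Vec d)} {ρlo ρhi : ℝ}

/-- The lower comparison with the Euclidean norm rules out the junk value of an unbounded supremum:
that value is `0`, which `ρlo * ‖u‖ ≤ 0` only allows at `u = 0`. -/
theorem bddAbove_inner_image (hρlo : 0 < ρlo) (hρ : ∀ v : Vec d, ρlo * ‖v‖ ≤ dualNorm N v)
    (u : Vec d) : BddAbove ((fun v : Vec d => inner ℝ u v) '' {v | N v ≤ 1}) := by
  by_contra h
  have h0 : dualNorm N u = 0 := Real.sSup_of_not_bddAbove h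
  have h1 := hρ u
  rw [h0] at h1
  have hu : u = 0 := by
    rw [← norm_eq_zero]
    nlinarith [norm_nonneg u]
  refine h ⟨0, ?_⟩
  rintro _ ⟨v, -, rfl⟩
  simp [hu]

theorem inner_le_dualNorm_of_le_one
    (hb : ∀ u : Vec d, BddAbove ((fun v : Vec d => inner ℝ u v) '' {v | N v ≤ 1}))
    (u : Vec d) {v : Vec d} (hv : N v ≤ 1) : inner ℝ u v ≤ dualNorm N u :=
  le_csSup (hb u) ⟨v, hv, rfl⟩

theorem dualNorm_le {u : Vec d} {c : ℝ} (h : ∀ v, N v ≤ 1 → inner ℝ u v ≤ c) :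
    dualNorm N u ≤ c := by
  refine csSup_le ⟨_, 0, by simp, rfl⟩ ?_
  rintro _ ⟨v, hv, rfl⟩
  exact h v hv

/-- The dual norm, bundled as a seminorm. -/
noncomputable def dualSeminorm (N : Seminorm ℝ (Vec d))
    (hb : ∀ u : Vec d, BddAbove ((fun v : Vec d => inner ℝ u v) '' {v | N v ≤ 1})) :
    Seminorm ℝ (Vec d) :=
  Seminorm.ofSMulLE (dualNorm N)
    (le_antisymm (dualNorm_le fun v _ => by simp)
      (by simpa using inner_le_dualNorm_of_le_one hb 0 (v := 0) (by simp)))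
    (fun u w => dualNorm_le fun v hv => by
      rw [inner_add_left]
      exact add_le_add (inner_le_dualNorm_of_le_one hb u hv) (inner_le_dualNorm_of_le_one hb w hv))
    (fun c u => dualNorm_le fun v hv => by
      rcases le_total 0 c with hc | hc
      · rw [real_inner_smul_left, Real.norm_of_nonneg hc]
        exact mul_le_mul_of_nonneg_left (inner_le_dualNorm_of_le_one hb u hv) hc
      · have h := inner_le_dualNorm_of_le_one hb u (v := -v) (by simpa using hv)
        rw [inner_neg_right] at h
        rw [real_inner_smul_left, Real.norm_of_nonpos hc]
        nlinarith)

theorem inner_le_dualNorm_mul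
    (hb : ∀ u : Vec d, BddAbove ((fun v : Vec d => inner ℝ u v) '' {v | N v ≤ 1}))
    (hN : ∀ v, N v = 0 → v = 0) (u v : Vec d) : inner ℝ u v ≤ dualNorm N u * N v := by
  rcases eq_or_ne (N v) 0 with h | h
  · simp [hN v h]
  · have hp : 0 < N v := lt_of_le_of_ne (apply_nonneg N v) h.symm
    have := inner_le_dualNorm_of_le_one hb u (v := (N v)⁻¹ • v) (by
      rw [map_smul_eq_mul, norm_inv, Real.norm_of_nonneg hp.le, inv_mul_cancel₀ h])
    rw [real_inner_smul_right, inv_mul_le_iff₀ hp] at this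
    linarith

/-- The linear minimization oracle over the ball of radius `r` attains `-r ‖m‖_*`. -/
theorem IsLMO.inner_le {r : ℝ} (hr : 0 < r) {m v : Vec d} (h : IsLMO N r m v) :
    inner ℝ m v ≤ -(r * dualNorm N m) := by
  have : dualNorm N m ≤ -inner ℝ m v / r := dualNorm_le fun w hw => by
    have h1 := h.2 (-(r • w)) (by
      rw [map_neg_eq_map, map_smul_eq_mul, Real.norm_of_nonneg hr.le]
      nlinarith [apply_nonneg N w])
    rw [inner_neg_right, real_inner_smul_right] at h1
    rw [le_div_iff₀ hr]
    linarith
  rw [le_div_iff₀ hr] at this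
  linarith

end DualNorm

theorem Seminorm.continuous_of_le_norm {E : Type*} [NormedAddCommGroup E] [NormedSpace ℝ E]
    (q : Seminorm ℝ E) {c : ℝ} (hc : 0 ≤ c) (h : ∀ v, q v ≤ c * ‖v‖) : Continuous q := by
  refine (LipschitzWith.of_dist_le_mul (K := c.toNNReal) fun u v => ?_).continuous
  rw [Real.dist_eq, Real.coe_toNNReal c hc, dist_eq_norm]
  exact (abs_sub_map_le_sub q u v).trans (h _)

/-! ### Grönwall's inequality for a curve of random vectors -/

theorem eLpNorm_two_sq {Ξ ε : Type*} [MeasurableSpace Ξ] {μ : Measure Ξ} [ENorm ε] (f : Ξ → ε) :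
    eLpNorm f 2 μ ^ 2 = ∫⁻ s, ‖f s‖ₑ ^ 2 ∂μ := by
  rw [eLpNorm_eq_lintegral_rpow_enorm_toReal (by simp) (by simp), ← ENNReal.rpow_natCast,
    ← ENNReal.rpow_mul]
  simp

theorem eLpNorm_two_le_of_sq_le {Ξ ε : Type*} [MeasurableSpace Ξ] {μ : Measure Ξ} [ENorm ε]
    {f : Ξ → ε} {c : ℝ≥0∞} (h : ∫⁻ s, ‖f s‖ₑ ^ 2 ∂μ ≤ c ^ 2) : eLpNorm f 2 μ ≤ c := by
  rw [← eLpNorm_two_sq] at h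
  exact (ENNReal.pow_le_pow_left_iff two_ne_zero).1 h

/-- The supremum of a continuous function over an interval is a countable supremum, so it is
measurable in a parameter. -/
theorem measurable_iSup_Icc {Ξ : Type*} [MeasurableSpace Ξ] {g : Ξ → ℝ → ℝ≥0∞} {a b : ℝ}
    (hab : a ≤ b) (hc : ∀ s, Continuous (g s)) (hm : ∀ t, Measurable fun s => g s t) :
    Measurable fun s => ⨆ u ∈ Set.Icc a b, g s u := by
  have key : ∀ s, (⨆ u ∈ Set.Icc a b, g s u) = ⨆ p : ℚ, g s (Set.projIcc a b hab p) := by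
    intro s
    refine le_antisymm (iSup₂_le fun u hu => ?_) (iSup_le fun p => ?_)
    · have hclosed : IsClosed {t : ℝ | g s (Set.projIcc a b hab t) ≤
          ⨆ p : ℚ, g s (Set.projIcc a b hab p)} :=
        isClosed_le ((hc s).comp (continuous_subtype_val.comp continuous_projIcc))
          continuous_const
      have h1 := Rat.denseRange_cast.induction_on (p := fun t : ℝ =>
        g s (Set.projIcc a b hab t) ≤ ⨆ p : ℚ, g s (Set.projIcc a b hab p)) u hclosed
        (fun p => le_iSup (fun p : ℚ => g s (Set.projIcc a b hab p)) p)
      simpa [Set.projIcc_of_mem hab hu] using h1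
    · exact le_iSup₂ (f := fun u (_ : u ∈ Set.Icc a b) => g s u) _
        (Set.projIcc a b hab (p : ℝ)).2
  simp_rw [key]
  exact Measurable.iSup fun p => hm _

theorem tendsto_iSup_Icc {g : ℝ → ℝ≥0∞} (hg : Continuous g) (t : ℝ) :
    Filter.Tendsto (fun z => ⨆ u ∈ Set.Icc t z, g u) (nhdsWithin t (Set.Ioi t)) (nhds (g t)) := by
  rw [tendsto_order]
  constructor
  · intro a ha
    filter_upwards [self_mem_nhdsWithin] with z hz
    exact ha.trans_le (le_iSup₂ (f := fun u (_ : u ∈ Set.Icc t z) => g u) t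
      ⟨le_rfl, le_of_lt hz⟩)
  · intro a ha
    obtain ⟨c, hc, hca⟩ := exists_between ha
    obtain ⟨ε, hε, hball⟩ := Metric.eventually_nhds_iff.1 (hg.continuousAt.eventually_lt_const hc)
    filter_upwards [Ioo_mem_nhdsGT (show t < t + ε by linarith)] with z hz
    refine lt_of_le_of_lt (iSup₂_le fun u hu => (hball ?_).le) hca
    rw [Real.dist_eq, abs_lt]
    constructor <;> linarith [hu.1, hu.2, hz.2]

/-- Grönwall's inequality for a continuous function whose upper right difference quotient is
controlled through a modulus `M t z` that is continuous as `z ↓ t`. -/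
theorem le_mul_exp_of_difference_quotient_le {h M₀ : ℝ → ℝ} {M : ℝ → ℝ → ℝ} {A b r : ℝ}
    (hA : 0 ≤ A) (hb : 0 ≤ b) (hr : 0 ≤ r) (h0 : h 0 = 0) (hcont : ContinuousOn h (Set.Icc 0 1))
    (hstep : ∀ t z, 0 ≤ t → t < z → z ≤ 1 → h z - h t ≤ M t z * (r * (z - t)))
    (hlim : ∀ t, 0 ≤ t → t < 1 →
      Filter.Tendsto (M t) (nhdsWithin t (Set.Ioi t)) (nhds (M₀ t)))
    (hbound : ∀ t, 0 ≤ t → t < 1 → M₀ t ≤ A + b * h t) :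
    h 1 ≤ A * (r * Real.exp (b * r)) := by
  have key := le_gronwallBound_of_liminf_deriv_right_le (f := h) (f' := fun t => M₀ t * r)
    (δ := 0) (K := b * r) (ε := A * r) hcont
    (by
      intro t ht R hR
      refine Filter.Eventually.frequently ?_
      filter_upwards [((hlim t ht.1 ht.2).mul_const r).eventually_lt_const hR,
        Ioo_mem_nhdsGT ht.2] with z hz hz1
      have hzt : 0 < z - t := sub_pos.2 hz1.1
      refine lt_of_le_of_lt ?_ hz
      rw [inv_mul_le_iff₀ hzt]
      linarith [hstep t z ht.1 hz1.1 hz1.2.le])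
    h0.le
    (by
      intro t ht
      have := mul_le_mul_of_nonneg_right (hbound t ht.1 ht.2) hr
      linarith)
    1 (by simp)
  refine key.trans ?_
  unfold gronwallBound
  have hbr := mul_nonneg hb hr
  split_ifs with hK
  · rw [hK]; simp
  · have hpos : 0 < b * r := lt_of_le_of_ne hbr (Ne.symm hK)
    have h1 := Real.one_sub_le_exp_neg (b * r)
    rw [Real.exp_neg] at h1
    have he := Real.exp_pos (b * r)
    have h2 : Real.exp (b * r) - 1 ≤ b * r * Real.exp (b * r) := by
      have := mul_le_mul_of_nonneg_right h1 he.le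
      rw [inv_mul_cancel₀ he.ne'] at this
      linarith
    have h3 : A * r / (b * r) * (Real.exp (b * r) - 1) ≤
        A * r / (b * r) * (b * r * Real.exp (b * r)) :=
      mul_le_mul_of_nonneg_left h2 (by positivity)
    calc _ ≤ A * r / (b * r) * (b * r * Real.exp (b * r)) := by simpa using h3
      _ = A * (r * Real.exp (b * r)) := by
        rw [← mul_assoc, div_mul_cancel₀ _ hK, mul_assoc]

section Curve

variable {Ξ E : Type*} [MeasurableSpace Ξ] [NormedAddCommGroup E] [NormedSpace ℝ E]
  [MeasurableSpace E] [BorelSpace E]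

theorem Seminorm.measurable_ofReal (q : Seminorm ℝ E) (hq : Continuous q) {φ : Ξ → E}
    (hφ : Measurable φ) : Measurable fun s => ENNReal.ofReal (q (φ s)) :=
  (hq.measurable.comp hφ).ennreal_ofReal

/-- Triangle inequality for the seminorm `q` in the second mean. -/
theorem eLpNorm_seminorm_le_add (q : Seminorm ℝ E) (hq : Continuous q) (μ : Measure Ξ)
    {f g h : Ξ → E} (hg : Measurable g) (hh : Measurable h)
    (hle : ∀ s, q (f s) ≤ q (g s) + q (h s)) :
    eLpNorm (fun s => ENNReal.ofReal (q (f s))) 2 μ ≤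
      eLpNorm (fun s => ENNReal.ofReal (q (g s))) 2 μ +
      eLpNorm (fun s => ENNReal.ofReal (q (h s))) 2 μ := by
  refine le_trans (eLpNorm_mono_enorm (g := (fun s => ENNReal.ofReal (q (g s))) +
      fun s => ENNReal.ofReal (q (h s))) fun s => ?_)
    (eLpNorm_add_le (q.measurable_ofReal hq hg).aestronglyMeasurable
      (q.measurable_ofReal hq hh).aestronglyMeasurable (by norm_num))
  simp only [enorm_eq_self, Pi.add_apply]
  rw [← ENNReal.ofReal_add (apply_nonneg _ _) (apply_nonneg _ _)]
  exact ENNReal.ofReal_le_ofReal (hle s)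

variable [SecondCountableTopology E]

/-- A random curve that is Lipschitz in the second mean with modulus
`b₀ + b₁ sup ‖φ‖` over each subinterval is Lipschitz with the modulus `b₀ + b₁ ‖φ 0‖` at its start,
up to an exponential factor. Dominated convergence identifies the local modulus with
`b₀ + b₁ ‖φ t‖`, after which Grönwall's inequality applies to `t ↦ ‖φ t - φ 0‖_{L²}`. -/
theorem eLpNorm_curve_le (q : Seminorm ℝ E) (hq : Continuous q) (μ : Measure Ξ)
    {φ : Ξ → ℝ → E} (hφc : ∀ s, Continuous (φ s)) (hφm : ∀ t, Measurable fun s => φ s t)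
    {b₀ b₁ r : ℝ} (hb₁ : 0 ≤ b₁) (hr : 0 ≤ r)
    (hfin : eLpNorm (fun s => ENNReal.ofReal b₀ + ENNReal.ofReal b₁ *
      ⨆ u ∈ Set.Icc (0 : ℝ) 1, ENNReal.ofReal (q (φ s u))) 2 μ < ∞)
    (hlip : ∀ t z, 0 ≤ t → t ≤ z → z ≤ 1 →
      eLpNorm (fun s => ENNReal.ofReal (q (φ s z - φ s t))) 2 μ ≤
        eLpNorm (fun s => ENNReal.ofReal b₀ + ENNReal.ofReal b₁ *
          ⨆ u ∈ Set.Icc t z, ENNReal.ofReal (q (φ s u))) 2 μ * ENNReal.ofReal (r * (z - t))) :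
    eLpNorm (fun s => ENNReal.ofReal (q (φ s 1 - φ s 0))) 2 μ ≤
      eLpNorm (fun s => ENNReal.ofReal b₀ + ENNReal.ofReal b₁ * ENNReal.ofReal (q (φ s 0))) 2 μ *
        ENNReal.ofReal (r * Real.exp (b₁ * r)) := by
  set S : ℝ → ℝ → ℝ≥0∞ := fun t z => eLpNorm (fun s => ENNReal.ofReal b₀ + ENNReal.ofReal b₁ *
          ⨆ u ∈ Set.Icc t z, ENNReal.ofReal (q (φ s u))) 2 μ with hS
  set T : ℝ → ℝ≥0∞ := fun t => eLpNorm (fun s => ENNReal.ofReal b₀ + ENNReal.ofReal b₁ *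
          ENNReal.ofReal (q (φ s t))) 2 μ with hT
  set H : ℝ → ℝ → ℝ≥0∞ := fun t z =>
    eLpNorm (fun s => ENNReal.ofReal (q (φ s z - φ s t))) 2 μ with hH
  have hgc : ∀ s, Continuous fun u => ENNReal.ofReal (q (φ s u)) := fun s =>
    ENNReal.continuous_ofReal.comp (hq.comp (hφc s))
  have hgm : ∀ u, Measurable fun s => ENNReal.ofReal (q (φ s u)) := fun u =>
    q.measurable_ofReal hq (hφm u)
  have hsupmono : ∀ t z, 0 ≤ t → z ≤ 1 → ∀ s, (⨆ u ∈ Set.Icc t z, ENNReal.ofReal (q (φ s u))) ≤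
      ⨆ u ∈ Set.Icc (0 : ℝ) 1, ENNReal.ofReal (q (φ s u)) := fun t z ht hz s =>
    biSup_mono fun u hu => ⟨ht.trans hu.1, hu.2.trans hz⟩
  have hSmono : ∀ t z, 0 ≤ t → z ≤ 1 → S t z ≤ S 0 1 := by
    intro t z ht hz
    refine eLpNorm_mono_enorm fun s => ?_
    simp only [enorm_eq_self]
    gcongr ENNReal.ofReal b₀ + ENNReal.ofReal b₁ * ?_
    exact hsupmono t z ht hz s
  have hTS : ∀ t, 0 ≤ t → t ≤ 1 → T t ≤ S 0 1 := by
    intro t ht ht1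
    refine eLpNorm_mono_enorm fun s => ?_
    simp only [enorm_eq_self]
    gcongr
    exact le_iSup₂ (f := fun u (_ : u ∈ Set.Icc (0 : ℝ) 1) => ENNReal.ofReal (q (φ s u))) t
      ⟨ht, ht1⟩
  have hTfin : ∀ t, 0 ≤ t → t ≤ 1 → T t ≠ ∞ := fun t h0 h1 => ((hTS t h0 h1).trans_lt hfin).ne
  have hSfin : ∀ t z, 0 ≤ t → z ≤ 1 → S t z ≠ ∞ := fun t z h0 h1 =>
    ((hSmono t z h0 h1).trans_lt hfin).ne
  have hHfin : ∀ t z, 0 ≤ t → t ≤ z → z ≤ 1 → H t z ≠ ∞ := fun t z h0 h1 h2 =>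
    ((hlip t z h0 h1 h2).trans_lt
      (ENNReal.mul_lt_top (hSfin t z h0 h2).lt_top ENNReal.ofReal_lt_top)).ne
  have hHreal : ∀ t z, 0 ≤ t → t ≤ z → z ≤ 1 →
      (H t z).toReal ≤ (S t z).toReal * (r * (z - t)) := by
    intro t z h0 h1 h2
    have := ENNReal.toReal_mono (ENNReal.mul_ne_top (hSfin t z h0 h2) ENNReal.ofReal_ne_top)
      (hlip t z h0 h1 h2)
    rwa [ENNReal.toReal_mul, ENNReal.toReal_ofReal (mul_nonneg hr (sub_nonneg.2 h1))] at this
  have htri1 : ∀ t z, 0 ≤ t → t ≤ z → z ≤ 1 → (H 0 z).toReal ≤ (H 0 t).toReal + (H t z).toReal := by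
    intro t z h0 h1 h2
    rw [← ENNReal.toReal_add (hHfin 0 t le_rfl h0 (h1.trans h2)) (hHfin t z h0 h1 h2)]
    refine ENNReal.toReal_mono (ENNReal.add_ne_top.2 ⟨hHfin 0 t le_rfl h0 (h1.trans h2),
      hHfin t z h0 h1 h2⟩) ?_
    refine eLpNorm_seminorm_le_add q hq μ ((hφm t).sub (hφm 0)) ((hφm z).sub (hφm t)) fun s => ?_
    simpa using map_add_le_add q (φ s t - φ s 0) (φ s z - φ s t)
  have htri2 : ∀ t z, 0 ≤ t → t ≤ z → z ≤ 1 → (H 0 t).toReal ≤ (H 0 z).toReal + (H t z).toReal := by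
    intro t z h0 h1 h2
    rw [← ENNReal.toReal_add (hHfin 0 z le_rfl (h0.trans h1) h2) (hHfin t z h0 h1 h2)]
    refine ENNReal.toReal_mono (ENNReal.add_ne_top.2 ⟨hHfin 0 z le_rfl (h0.trans h1) h2,
      hHfin t z h0 h1 h2⟩) ?_
    refine eLpNorm_seminorm_le_add q hq μ ((hφm z).sub (hφm 0)) ((hφm z).sub (hφm t)) fun s => ?_
    have := map_sub_le_add q (φ s z - φ s 0) (φ s z - φ s t)
    simpa using this
  have hlipabs : ∀ t z, 0 ≤ t → t ≤ z → z ≤ 1 →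
      |(H 0 t).toReal - (H 0 z).toReal| ≤ (S 0 1).toReal * r * (z - t) := by
    intro t z h0 h1 h2
    have a1 := htri1 t z h0 h1 h2
    have a2 := htri2 t z h0 h1 h2
    have a3 := hHreal t z h0 h1 h2
    have a4 := ENNReal.toReal_mono hfin.ne (hSmono t z h0 h2)
    have a5 : (S t z).toReal * (r * (z - t)) ≤ (S 0 1).toReal * (r * (z - t)) :=
      mul_le_mul_of_nonneg_right a4 (mul_nonneg hr (sub_nonneg.2 h1))
    rw [abs_le]
    constructor <;> nlinarith
  have hcont : ContinuousOn (fun t => (H 0 t).toReal) (Set.Icc 0 1) := by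
    refine (LipschitzOnWith.of_dist_le_mul (K := ((S 0 1).toReal * r).toNNReal)
      fun t ht z hz => ?_).continuousOn
    rw [Real.coe_toNNReal _ (by positivity), Real.dist_eq, Real.dist_eq]
    rcases le_total t z with htz | htz
    · rw [abs_sub_comm t z, abs_of_nonneg (sub_nonneg.2 htz)]
      exact hlipabs t z ht.1 htz hz.2
    · rw [abs_of_nonneg (sub_nonneg.2 htz), abs_sub_comm]
      exact hlipabs z t hz.1 htz ht.2
  have hlim : ∀ t, 0 ≤ t → t < 1 → Filter.Tendsto (fun z => (S t z).toReal)
      (nhdsWithin t (Set.Ioi t)) (nhds (T t).toReal) := by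
    intro t h0 h1
    refine (ENNReal.tendsto_toReal (hTfin t h0 h1.le)).comp ?_
    simp only [hS, hT]
    simp_rw [eLpNorm_eq_lintegral_rpow_enorm_toReal (p := 2) two_ne_zero ENNReal.ofNat_ne_top]
    refine (ENNReal.continuous_rpow_const.tendsto _).comp ?_
    refine tendsto_lintegral_filter_of_dominated_convergence
      (fun s => ‖ENNReal.ofReal b₀ + ENNReal.ofReal b₁ *
        ⨆ u ∈ Set.Icc (0 : ℝ) 1, ENNReal.ofReal (q (φ s u))‖ₑ ^ (2 : ℝ≥0∞).toReal) ?_ ?_ ?_ ?_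
    · filter_upwards [self_mem_nhdsWithin] with z hz
      exact (((measurable_iSup_Icc (le_of_lt hz) hgc hgm).const_mul _).const_add _).enorm.pow_const _
    · filter_upwards [Ioo_mem_nhdsGT h1] with z hz
      refine Filter.Eventually.of_forall fun s => ?_
      simp only [enorm_eq_self]
      gcongr (ENNReal.ofReal b₀ + ENNReal.ofReal b₁ * ?_) ^ _
      exact hsupmono t z h0 hz.2.le s
    · simp only [ENNReal.toReal_ofNat, ENNReal.rpow_ofNat]
      rw [← eLpNorm_two_sq]
      exact ENNReal.pow_ne_top hfin.ne
    · refine Filter.Eventually.of_forall fun s => ?_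
      simp only [enorm_eq_self]
      refine (ENNReal.continuous_rpow_const.tendsto _).comp ?_
      exact (ENNReal.Tendsto.const_mul (tendsto_iSup_Icc (hgc s) t)
        (Or.inr ENNReal.ofReal_ne_top)).const_add _
  have hbound : ∀ t, 0 ≤ t → t < 1 → (T t).toReal ≤ (T 0).toReal + b₁ * (H 0 t).toReal := by
    intro t h0 h1
    have hf := hHfin 0 t le_rfl h0 h1.le
    have : T t ≤ T 0 + ENNReal.ofReal b₁ * H 0 t := by
      have e1 : ENNReal.ofReal b₁ * H 0 t =
          eLpNorm (fun s => ENNReal.ofReal b₁ * ENNReal.ofReal (q (φ s t - φ s 0))) 2 μ := by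
        have hs := eLpNorm_const_smul b₁ (fun s => q (φ s t - φ s 0)) 2 μ
        rw [Real.enorm_eq_ofReal hb₁] at hs
        simp only [hH]
        rw [show eLpNorm (fun s => ENNReal.ofReal (q (φ s t - φ s 0))) 2 μ =
          eLpNorm (fun s => q (φ s t - φ s 0)) 2 μ from eLpNorm_congr_enorm_ae
            (Filter.Eventually.of_forall fun s => by
              simp [Real.enorm_eq_ofReal (apply_nonneg q _)]), ← hs]
        refine eLpNorm_congr_enorm_ae (Filter.Eventually.of_forall fun s => ?_)
        simp [Real.enorm_eq_ofReal (apply_nonneg q _), Real.enorm_eq_ofReal hb₁, enorm_mul]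
      rw [e1]
      refine le_trans (eLpNorm_mono_enorm (g := (fun s => ENNReal.ofReal b₀ + ENNReal.ofReal b₁ *
          ENNReal.ofReal (q (φ s 0))) + fun s => ENNReal.ofReal b₁ *
          ENNReal.ofReal (q (φ s t - φ s 0))) fun s => ?_)
        (eLpNorm_add_le (((hgm 0).const_mul _).const_add _).aestronglyMeasurable
          ((q.measurable_ofReal hq ((hφm t).sub (hφm 0))).const_mul _).aestronglyMeasurable
          (by norm_num))
      simp only [enorm_eq_self, Pi.add_apply]
      rw [add_assoc, ← mul_add, ← ENNReal.ofReal_add (apply_nonneg _ _) (apply_nonneg _ _)]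
      gcongr
      simpa using map_add_le_add q (φ s 0) (φ s t - φ s 0)
    have := ENNReal.toReal_mono (ENNReal.add_ne_top.2 ⟨hTfin 0 le_rfl zero_le_one,
      ENNReal.mul_ne_top ENNReal.ofReal_ne_top hf⟩) this
    rwa [ENNReal.toReal_add (hTfin 0 le_rfl zero_le_one)
      (ENNReal.mul_ne_top ENNReal.ofReal_ne_top hf), ENNReal.toReal_mul,
      ENNReal.toReal_ofReal hb₁] at this
  have hfinal := le_mul_exp_of_difference_quotient_le (h := fun t => (H 0 t).toReal)
    (M := fun t z => (S t z).toReal) (M₀ := fun t => (T t).toReal) (A := (T 0).toReal) (b := b₁)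
    (r := r) ENNReal.toReal_nonneg hb₁ hr (by simp [hH]) hcont
    (fun t z h0 h1 h2 => by
      linarith [htri1 t z h0 h1.le h2, hHreal t z h0 h1.le h2]) hlim hbound
  change H 0 1 ≤ T 0 * _
  rw [← ENNReal.ofReal_toReal (hHfin 0 1 le_rfl zero_le_one le_rfl),
    ← ENNReal.ofReal_toReal (hTfin 0 le_rfl zero_le_one),
    ← ENNReal.ofReal_mul ENNReal.toReal_nonneg]
  exact ENNReal.ofReal_le_ofReal hfinal

end Curve

/-! ### Stochastic gradients -/

section Gradients

theorem continuous_gradient_of_contDiff {d : ℕ} {f : Vec d → ℝ} (hf : ContDiff ℝ 1 f) :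
    Continuous (gradient f) :=
  (InnerProductSpace.toDual ℝ (Vec d)).symm.continuous.comp (hf.continuous_fderiv one_ne_zero)

theorem measurable_gradient {d : ℕ} (f : Vec d → ℝ) : Measurable (gradient f) :=
  (InnerProductSpace.toDual ℝ (Vec d)).symm.continuous.measurable.comp (measurable_fderiv ℝ f)

/-- Each coordinate of the gradient is a limit of difference quotients, hence measurable in the
parameter. -/
theorem measurable_gradient_param {d : ℕ} {Ξ : Type*} [MeasurableSpace Ξ] {F : Ξ → Vec d → ℝ}
    (hF : ∀ v, Measurable fun s => F s v) (hd : ∀ s, Differentiable ℝ (F s)) (v : Vec d) :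
    Measurable fun s => gradient (F s) v := by
  have hcoord : ∀ w : Vec d, Measurable fun s => (inner ℝ (gradient (F s) v) w : ℝ) := by
    intro w
    refine measurable_of_tendsto_metrizable
      (f := fun (n : ℕ) s => (n : ℝ) • (F s (v + (n : ℝ)⁻¹ • w) - F s v))
      (fun n => ((hF (v + (n : ℝ)⁻¹ • w)).sub (hF v)).const_mul (n : ℝ)) ?_
    rw [tendsto_pi_nhds]
    intro s
    have h1 := ((hd s v).hasGradientAt.hasFDerivAt).lim_real w
    rw [InnerProductSpace.toDual_apply_apply] at h1
    exact h1.comp tendsto_natCast_atTop_atTop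
  have hsum : (fun s => gradient (F s) v) = fun s => ∑ i : Fin d,
      (inner ℝ (gradient (F s) v) (EuclideanSpace.basisFun (Fin d) ℝ i) : ℝ) •
        EuclideanSpace.basisFun (Fin d) ℝ i := by
    ext1 s
    conv_lhs => rw [← (EuclideanSpace.basisFun (Fin d) ℝ).sum_repr (gradient (F s) v)]
    refine Finset.sum_congr rfl fun i _ => ?_
    rw [OrthonormalBasis.repr_apply_apply, real_inner_comm]
  rw [hsum]
  exact Finset.measurable_sum _ fun i _ => (hcoord _).smul_const _

/-- The stochastic gradient is jointly measurable in the sample and the point. -/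
theorem measurable_gradient_uncurry {d : ℕ} {Ξ : Type*} [MeasurableSpace Ξ] {F : Ξ → Vec d → ℝ}
    (hF : ∀ v, Measurable fun s => F s v) (hd : ∀ s, ContDiff ℝ 1 (F s)) :
    Measurable fun p : Vec d × Ξ => gradient (F p.2) p.1 :=
  measurable_uncurry_of_continuous_of_measurable (u := fun v s => gradient (F s) v)
    (fun s => continuous_gradient_of_contDiff (hd s))
    (fun v => measurable_gradient_param hF (fun s => (hd s).differentiable one_ne_zero) v)

end Gradients

section Comparison

variable {Ξ E : Type*} [MeasurableSpace Ξ] [NormedAddCommGroup E] [NormedSpace ℝ E]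

theorem eLpNorm_ofReal_seminorm (q : Seminorm ℝ E) (μ : Measure Ξ) (u : Ξ → E) (p : ℝ≥0∞) :
    eLpNorm (fun s => ENNReal.ofReal (q (u s))) p μ = eLpNorm (fun s => q (u s)) p μ :=
  eLpNorm_congr_enorm_ae (Filter.Eventually.of_forall fun s => by
    simp [Real.enorm_eq_ofReal (apply_nonneg q _)])

theorem eLpNorm_seminorm_le (q : Seminorm ℝ E) {c : ℝ} (h : ∀ v, q v ≤ c * ‖v‖)
    (μ : Measure Ξ) (u : Ξ → E) :
    eLpNorm (fun s => ENNReal.ofReal (q (u s))) 2 μ ≤ ENNReal.ofReal c * eLpNorm u 2 μ := by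
  rw [eLpNorm_ofReal_seminorm]
  refine eLpNorm_le_mul_eLpNorm_of_ae_le_mul (Filter.Eventually.of_forall fun s => ?_) 2
  rw [Real.norm_of_nonneg (apply_nonneg q _)]
  exact h _

theorem eLpNorm_le_seminorm (q : Seminorm ℝ E) {c : ℝ} (hc : 0 < c) (h : ∀ v, c * ‖v‖ ≤ q v)
    (μ : Measure Ξ) (u : Ξ → E) :
    eLpNorm u 2 μ ≤ ENNReal.ofReal c⁻¹ * eLpNorm (fun s => ENNReal.ofReal (q (u s))) 2 μ := by
  rw [eLpNorm_ofReal_seminorm]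
  refine eLpNorm_le_mul_eLpNorm_of_ae_le_mul (Filter.Eventually.of_forall fun s => ?_) 2
  rw [Real.norm_of_nonneg (apply_nonneg q _), ← div_eq_inv_mul, le_div_iff₀ hc, mul_comm]
  exact h _

end Comparison

section Smoothness

variable {d : ℕ} {Ξ : Type*} [MeasurableSpace Ξ]

/-- On a segment, symmetric relaxed smoothness in the second mean yields the asymmetric estimate
in which the modulus is evaluated at one endpoint only. -/
theorem eLpNorm_sub_le_of_segmentSup (N q : Seminorm ℝ (Vec d)) (hqN : ∀ v, q v = dualNorm N v)
    (hqc : Continuous q) (μ : Measure Ξ) {G : Ξ → Vec d → Vec d}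
    (hGm : ∀ v, Measurable fun s => G s v) {b₀ b₁ : ℝ} (hb₁ : 0 ≤ b₁)
    (hfin : ∀ x y, eLpNorm (fun s => ENNReal.ofReal b₀ + ENNReal.ofReal b₁ *
      segmentSup N (G s) x y) 2 μ < ∞)
    (hlip : ∀ x y, eLpNorm (fun s => ENNReal.ofReal (q (G s x - G s y))) 2 μ ≤
      eLpNorm (fun s => ENNReal.ofReal b₀ + ENNReal.ofReal b₁ * segmentSup N (G s) x y) 2 μ *
        ENNReal.ofReal (N (x - y)))
    (x y : Vec d)
    (hGc : ∀ s, ContinuousOn (fun t : ℝ => G s (x + t • (y - x))) (Set.Icc 0 1)) :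
    eLpNorm (fun s => ENNReal.ofReal (q (G s y - G s x))) 2 μ ≤
      eLpNorm (fun s => ENNReal.ofReal b₀ + ENNReal.ofReal b₁ * ENNReal.ofReal (q (G s x))) 2 μ *
        ENNReal.ofReal (N (y - x) * Real.exp (b₁ * N (y - x))) := by
  set φ : Ξ → ℝ → Vec d := fun s => Set.IccExtend zero_le_one
    (Set.domRestrict (Set.Icc (0 : ℝ) 1) fun t : ℝ => G s (x + t • (y - x))) with hφ
  have hφv : ∀ s t, 0 ≤ t → t ≤ 1 → φ s t = G s (x + t • (y - x)) := fun s t h0 h1 => by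
    simp only [hφ]
    rw [Set.IccExtend_of_mem _ _ ⟨h0, h1⟩]
    rfl
  have key := eLpNorm_curve_le q hqc μ (φ := φ)
    (fun s => (continuousOn_iff_continuous_domRestrict.1 (hGc s)).Icc_extend')
    (fun t => hGm _) (b₀ := b₀) (b₁ := b₁) (r := N (y - x)) hb₁ (apply_nonneg _ _) ?_ ?_
  · simpa [hφv _ 1 zero_le_one le_rfl, hφv _ 0 le_rfl zero_le_one] using key
  · refine lt_of_le_of_lt (eLpNorm_mono_enorm fun s => ?_) (hfin y x)
    simp only [enorm_eq_self]
    gcongr ENNReal.ofReal b₀ + ENNReal.ofReal b₁ * ?_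
    refine iSup₂_le fun u hu => ?_
    rw [hφv s u hu.1 hu.2, hqN]
    refine le_trans (le_of_eq ?_) (le_iSup₂ (f := fun θ (_ : θ ∈ Set.Icc (0 : ℝ) 1) =>
      ENNReal.ofReal (dualNorm N (G s (θ • y + (1 - θ) • x)))) u hu)
    congr 3
    module
  · intro t z h0 h1 h2
    have hstep := hlip (x + z • (y - x)) (x + t • (y - x))
    have hN : N (x + z • (y - x) - (x + t • (y - x))) = N (y - x) * (z - t) := by
      rw [show x + z • (y - x) - (x + t • (y - x)) = (z - t) • (y - x) by module,
        map_smul_eq_mul, Real.norm_of_nonneg (sub_nonneg.2 h1), mul_comm]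
    rw [hN] at hstep
    simp only [hφv _ z (h0.trans h1) h2, hφv _ t h0 (h1.trans h2)]
    refine hstep.trans ?_
    gcongr
    refine eLpNorm_mono_enorm fun s => ?_
    simp only [enorm_eq_self]
    gcongr ENNReal.ofReal b₀ + ENNReal.ofReal b₁ * ?_
    refine iSup₂_le fun θ hθ => ?_
    have hu : θ * z + (1 - θ) * t ∈ Set.Icc t z := by
      constructor <;> nlinarith [hθ.1, hθ.2]
    refine le_trans (le_of_eq ?_) (le_iSup₂ (f := fun u (_ : u ∈ Set.Icc t z) =>
      ENNReal.ofReal (q (φ s u))) _ hu)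
    rw [hφv s _ (h0.trans hu.1) (hu.2.trans h2), hqN]
    congr 3
    module

/-- The second-mean estimate for a single deterministic vector field. -/
theorem seminorm_sub_le_of_segmentSup (N q : Seminorm ℝ (Vec d))
    (hqN : ∀ v, q v = dualNorm N v) (hqc : Continuous q) {G : Vec d → Vec d}
    {b₀ b₁ : ℝ} (hb₀ : 0 ≤ b₀) (hb₁ : 0 ≤ b₁)
    (hfin : ∀ x y, segmentSup N G x y < ∞)
    (hlip : ∀ x y, ENNReal.ofReal (dualNorm N (G x - G y)) ≤
      (ENNReal.ofReal b₀ + ENNReal.ofReal b₁ * segmentSup N G x y) * ENNReal.ofReal (N (x - y)))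
    (x y : Vec d)
    (hGc : ContinuousOn (fun t : ℝ => G (x + t • (y - x))) (Set.Icc 0 1)) :
    q (G y - G x) ≤ (b₀ + b₁ * q (G x)) * (N (y - x) * Real.exp (b₁ * N (y - x))) := by
  have hconst : ∀ c : ℝ≥0∞, eLpNorm (fun _ : Unit => c) 2 (Measure.dirac ()) = c := fun c => by
    rw [eLpNorm_eq_lintegral_rpow_enorm_toReal two_ne_zero ENNReal.ofNat_ne_top]
    rw [lintegral_dirac, enorm_eq_self, ← ENNReal.rpow_mul]
    norm_num
  have key := eLpNorm_sub_le_of_segmentSup N q hqN hqc (Measure.dirac ()) (G := fun _ : Unit => G)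
    (fun v => measurable_const) (b₀ := b₀) (b₁ := b₁) hb₁
    (fun x y => by
      rw [hconst]
      exact ENNReal.add_lt_top.2 ⟨ENNReal.ofReal_lt_top,
        ENNReal.mul_lt_top ENNReal.ofReal_lt_top (hfin x y)⟩)
    (fun x y => by rw [hconst, hconst, hqN]; exact hlip x y) x y (fun _ => hGc)
  have hq0 := apply_nonneg q (G x)
  have hN0 := apply_nonneg N (y - x)
  rw [hconst, hconst, ← ENNReal.ofReal_mul hb₁, ← ENNReal.ofReal_add hb₀ (by positivity),
    ← ENNReal.ofReal_mul (by positivity)] at key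
  exact (ENNReal.ofReal_le_ofReal_iff (by positivity)).1 key

/-- A descent inequality from the asymmetric estimate on the gradient. -/
theorem le_add_inner_of_gradient_sub_le {N : Seminorm ℝ (Vec d)}
    (hpair : ∀ u v : Vec d, inner ℝ u v ≤ dualNorm N u * N v) {f : Vec d → ℝ}
    (hf : Differentiable ℝ f) {c L : ℝ} (hc : 0 ≤ c) (hL : 0 ≤ L) (x y : Vec d)
    (h : ∀ z, dualNorm N (gradient f z - gradient f x) ≤
      c * (N (z - x) * Real.exp (L * N (z - x)))) :
    f y ≤ f x + inner ℝ (gradient f x) (y - x) +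
      c / 2 * Real.exp (L * N (y - x)) * N (y - x) ^ 2 := by
  set r := N (y - x) with hr
  have hr0 : 0 ≤ r := apply_nonneg _ _
  set e := Real.exp (L * r) with he
  have hline : ∀ t : ℝ, HasDerivAt (fun t : ℝ => x + t • (y - x)) (y - x) t := fun t => by
    simpa using ((hasDerivAt_id t).smul_const (y - x)).const_add x
  have hder : ∀ t : ℝ, HasDerivAt (fun t : ℝ => f (x + t • (y - x)))
      (inner ℝ (gradient f (x + t • (y - x))) (y - x)) t := fun t => by
    have := ((hf (x + t • (y - x))).hasGradientAt.hasFDerivAt).comp_hasDerivAt t (hline t)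
    rwa [InnerProductSpace.toDual_apply_apply] at this
  have key := image_le_of_deriv_right_le_deriv_boundary
    (f := fun t : ℝ => f (x + t • (y - x)))
    (f' := fun t => inner ℝ (gradient f (x + t • (y - x))) (y - x)) (a := 0) (b := 1)
    (fun t _ => (hder t).continuousAt.continuousWithinAt)
    (fun t _ => (hder t).hasDerivWithinAt)
    (B := fun t => f x + t * inner ℝ (gradient f x) (y - x) + c / 2 * e * r ^ 2 * t ^ 2)
    (B' := fun t => inner ℝ (gradient f x) (y - x) + c / 2 * e * r ^ 2 * (2 * t))
    (by simp) (by fun_prop)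
    (fun t _ => by
      have h1 := ((hasDerivAt_id t).mul_const (inner ℝ (gradient f x) (y - x))).const_add (f x)
      have h2 := (hasDerivAt_pow 2 t).const_mul (c / 2 * e * r ^ 2)
      rw [one_mul] at h1
      refine ((h1.add h2).congr_deriv ?_).hasDerivWithinAt
      norm_num)
    (fun t ht => by
      have hNt : N (x + t • (y - x) - x) = t * r := by
        rw [add_sub_cancel_left, map_smul_eq_mul, Real.norm_of_nonneg ht.1]
      have h1 := hpair (gradient f (x + t • (y - x)) - gradient f x) (y - x)
      have h2 := h (x + t • (y - x))
      rw [hNt] at h2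
      have h3 : Real.exp (L * (t * r)) ≤ e := Real.exp_le_exp.2
        (mul_le_mul_of_nonneg_left (by nlinarith [ht.2, ht.1]) hL)
      have h4 : c * (t * r * Real.exp (L * (t * r))) ≤ c * (t * r * e) := by
        have := mul_nonneg ht.1 hr0
        gcongr
      have h5 := mul_le_mul_of_nonneg_right (h2.trans h4) hr0
      rw [inner_sub_left] at h1
      linarith)
    (x := 1) (by simp)
  simpa using key

end Smoothness

/-! ### Consequences for the objective and its stochastic gradients -/

section Objective

variable {d : ℕ} {Ξ : Type*} [MeasurableSpace Ξ] {D : Measure Ξ}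
  {F : Ξ → Vec d → ℝ} {σ : ℝ}

theorem segmentSup_le_of_mem_segment (N : Seminorm ℝ (Vec d)) (G : Vec d → Vec d) (x y : Vec d)
    {t z : ℝ} (ht : t ∈ Set.Icc (0 : ℝ) 1) (hz : z ∈ Set.Icc (0 : ℝ) 1) :
    segmentSup N G (x + t • (y - x)) (x + z • (y - x)) ≤ segmentSup N G y x := by
  refine iSup₂_le fun θ hθ => ?_
  have hu : θ * t + (1 - θ) * z ∈ Set.Icc (0 : ℝ) 1 := by
    have h1 := mul_nonneg hθ.1 ht.1
    have h2 := mul_nonneg (sub_nonneg.2 hθ.2) hz.1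
    have h3 := mul_nonneg hθ.1 (sub_nonneg.2 ht.2)
    have h4 := mul_nonneg (sub_nonneg.2 hθ.2) (sub_nonneg.2 hz.2)
    constructor <;> nlinarith
  refine le_trans (le_of_eq ?_) (le_iSup₂ (f := fun θ (_ : θ ∈ Set.Icc (0 : ℝ) 1) =>
    ENNReal.ofReal (dualNorm N (G (θ • y + (1 - θ) • x)))) _ hu)
  congr 3
  module

theorem lintegral_enorm_sq_eq_ofReal_integral {Ω E : Type*} [MeasurableSpace Ω] {μ : Measure Ω}
    [NormedAddCommGroup E] {u : Ω → E} (h : Integrable (fun s => ‖u s‖ ^ 2) μ) :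
    ∫⁻ s, ‖u s‖ₑ ^ 2 ∂μ = ENNReal.ofReal (∫ s, ‖u s‖ ^ 2 ∂μ) := by
  rw [ofReal_integral_eq_lintegral_ofReal h (Filter.Eventually.of_forall fun s => by positivity)]
  refine lintegral_congr fun s => ?_
  rw [ENNReal.ofReal_pow (norm_nonneg _), ofReal_norm]

theorem UnbiasedBoundedVariance.eLpNorm_le (h : UnbiasedBoundedVariance D F σ) (hσ : 0 ≤ σ)
    (x : Vec d) :
    eLpNorm (fun s => gradient (F s) x - gradient (objective D F) x) 2 D ≤ ENNReal.ofReal σ := by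
  obtain ⟨-, -, h1, h2⟩ := h x
  refine eLpNorm_two_le_of_sq_le ?_
  rw [lintegral_enorm_sq_eq_ofReal_integral h1, ← ENNReal.ofReal_pow hσ]
  exact ENNReal.ofReal_le_ofReal h2

variable {N q : Seminorm ℝ (Vec d)} {ρlo ρhi ℒ₀ ℒ₁ : ℝ}

theorem MeanSquaredRelaxedSmooth.eLpNorm_lt_top (h : MeanSquaredRelaxedSmooth D N ℒ₀ ℒ₁ F)
    (x y : Vec d) : eLpNorm (fun s => ENNReal.ofReal ℒ₀ + ENNReal.ofReal ℒ₁ *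
      segmentSup N (gradient (F s)) x y) 2 D < ∞ := by
  have h1 := (h x y).1
  have h2 := eLpNorm_two_sq (μ := D) (fun s => ENNReal.ofReal ℒ₀ + ENNReal.ofReal ℒ₁ *
      segmentSup N (gradient (F s)) x y)
  simp only [enorm_eq_self] at h2
  rw [← h2] at h1
  by_contra hc
  rw [not_lt, top_le_iff] at hc
  rw [hc] at h1
  simp at h1

theorem MeanSquaredRelaxedSmooth.eLpNorm_le (h : MeanSquaredRelaxedSmooth D N ℒ₀ ℒ₁ F)
    (hqN : ∀ v, q v = dualNorm N v) (x y : Vec d) :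
    eLpNorm (fun s => ENNReal.ofReal (q (gradient (F s) x - gradient (F s) y))) 2 D ≤
      eLpNorm (fun s => ENNReal.ofReal ℒ₀ + ENNReal.ofReal ℒ₁ *
        segmentSup N (gradient (F s)) x y) 2 D * ENNReal.ofReal (N (x - y)) := by
  refine eLpNorm_two_le_of_sq_le ?_
  rw [mul_pow, eLpNorm_two_sq]
  simp only [enorm_eq_self, hqN]
  exact (h x y).2

variable [IsProbabilityMeasure D]

theorem UnbiasedBoundedVariance.enorm_sub_le (h : UnbiasedBoundedVariance D F σ)
    (x y : Vec d) : ‖gradient (objective D F) y - gradient (objective D F) x‖ₑ ≤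
      eLpNorm (fun s => gradient (F s) y - gradient (F s) x) 2 D := by
  obtain ⟨hx1, hx2, -, -⟩ := h x
  obtain ⟨hy1, hy2, -, -⟩ := h y
  rw [← hx2, ← hy2, ← integral_sub hy1 hx1]
  refine (enorm_integral_le_lintegral_enorm _).trans ?_
  rw [← eLpNorm_one_eq_lintegral_enorm]
  exact eLpNorm_le_eLpNorm_of_exponent_le (by norm_num) (hy1.sub hx1).aestronglyMeasurable

/-- The mean gradient inherits Lipschitz continuity along every segment: there, the integrable
modulus of the whole segment serves all pairs of points. -/
theorem MeanSquaredRelaxedSmooth.lipschitzOnWith (h : MeanSquaredRelaxedSmooth D N ℒ₀ ℒ₁ F)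
    (hvar : UnbiasedBoundedVariance D F σ) (hqN : ∀ v, q v = dualNorm N v)
    (hρlo : 0 < ρlo) (hq : ∀ v, ρlo * ‖v‖ ≤ q v) (x y : Vec d) :
    ∃ C : NNReal, LipschitzOnWith C
      (fun t : ℝ => gradient (objective D F) (x + t • (y - x))) (Set.Icc 0 1) := by
  set A := eLpNorm (fun s => ENNReal.ofReal ℒ₀ + ENNReal.ofReal ℒ₁ *
      segmentSup N (gradient (F s)) y x) 2 D with hA
  have hAtop : A ≠ ∞ := (h.eLpNorm_lt_top y x).ne
  refine ⟨(ENNReal.ofReal ρlo⁻¹ * (A * ENNReal.ofReal (N (y - x)))).toNNReal, fun t ht z hz => ?_⟩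
  rw [ENNReal.coe_toNNReal (by finiteness)]
  rw [edist_eq_enorm_sub]
  refine (hvar.enorm_sub_le _ _).trans ((eLpNorm_le_seminorm q hρlo hq D _).trans ?_)
  rw [mul_assoc]
  gcongr
  refine (h.eLpNorm_le hqN _ _).trans ?_
  have hN : N (x + t • (y - x) - (x + z • (y - x))) = N (y - x) * |t - z| := by
    rw [show x + t • (y - x) - (x + z • (y - x)) = (t - z) • (y - x) by module,
      map_smul_eq_mul, Real.norm_eq_abs, mul_comm]
  rw [hN, ENNReal.ofReal_mul (apply_nonneg _ _), mul_assoc, edist_dist, Real.dist_eq]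
  gcongr
  refine eLpNorm_mono_enorm fun s => ?_
  simp only [enorm_eq_self]
  gcongr ENNReal.ofReal ℒ₀ + ENNReal.ofReal ℒ₁ * ?_
  exact segmentSup_le_of_mem_segment N _ x y ht hz

theorem segmentSup_lt_top_of_lipschitzOnWith {G : Vec d → Vec d} (hqN : ∀ v, q v = dualNorm N v)
    (hρhi : 0 ≤ ρhi) (hq : ∀ v, q v ≤ ρhi * ‖v‖) (x y : Vec d) {C : NNReal}
    (h : LipschitzOnWith C (fun t : ℝ => G (y + t • (x - y))) (Set.Icc 0 1)) :
    segmentSup N G x y < ∞ := by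
  refine lt_of_le_of_lt (iSup₂_le fun θ hθ => ?_)
    (ENNReal.ofReal_lt_top (r := ρhi * (‖G y‖ + C)))
  refine ENNReal.ofReal_le_ofReal ?_
  rw [← hqN]
  refine (hq _).trans (mul_le_mul_of_nonneg_left ?_ hρhi)
  have h1 := h.dist_le_mul θ hθ 0 (by simp)
  rw [show θ • x + (1 - θ) • y = y + θ • (x - y) by module]
  simp only [zero_smul, add_zero, dist_eq_norm, sub_zero] at h1
  have h2 : (C : ℝ) * ‖θ‖ ≤ C * 1 := by
    gcongr
    rw [Real.norm_of_nonneg hθ.1]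
    exact hθ.2
  have h3 := norm_le_norm_add_norm_sub' (G (y + θ • (x - y))) (G y)
  linarith

/-- The asymmetric relaxed Lipschitz estimate for the gradient of the objective. The mean-squared
hypothesis enters only to make the suprema over segments finite. -/
theorem RelaxedSmooth.sub_le {L₀ L₁ : ℝ} (hs : RelaxedSmooth N L₀ L₁ (objective D F))
    (hL₀ : 0 ≤ L₀) (hL₁ : 0 ≤ L₁)
    (hms : MeanSquaredRelaxedSmooth D N ℒ₀ ℒ₁ F)
    (hvar : UnbiasedBoundedVariance D F σ) (hqN : ∀ v, q v = dualNorm N v)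
    (hρlo : 0 < ρlo) (hqlo : ∀ v, ρlo * ‖v‖ ≤ q v) (hρhi : 0 ≤ ρhi)
    (hqhi : ∀ v, q v ≤ ρhi * ‖v‖) (x y : Vec d) :
    q (gradient (objective D F) y - gradient (objective D F) x) ≤
      (L₀ + L₁ * q (gradient (objective D F) x)) *
        (N (y - x) * Real.exp (L₁ * N (y - x))) := by
  refine seminorm_sub_le_of_segmentSup N q hqN (q.continuous_of_le_norm hρhi hqhi) hL₀ hL₁
    (fun x y => ?_) hs.2 x y ?_
  · obtain ⟨C, hC⟩ := hms.lipschitzOnWith hvar hqN hρlo hqlo y x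
    exact segmentSup_lt_top_of_lipschitzOnWith hqN hρhi hqhi x y hC
  · obtain ⟨C, hC⟩ := hms.lipschitzOnWith hvar hqN hρlo hqlo x y
    exact hC.continuousOn

/-- Second-mean bound on the increments of the stochastic gradients, with the modulus evaluated at
the mean gradient: the noise of `∇f_ξ(x)` costs `ℒ₁ ρ̄ σ`. -/
theorem MeanSquaredRelaxedSmooth.eLpNorm_increment_le
    (hms : MeanSquaredRelaxedSmooth D N ℒ₀ ℒ₁ F) (hℒ₀ : 0 ≤ ℒ₀) (hℒ₁ : 0 ≤ ℒ₁)
    (hF : ∀ v, Measurable fun s => F s v) (hd : ∀ s, ContDiff ℝ 1 (F s))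
    (hvar : UnbiasedBoundedVariance D F σ) (hσ : 0 ≤ σ) (hqN : ∀ v, q v = dualNorm N v)
    (hρlo : 0 < ρlo) (hqlo : ∀ v, ρlo * ‖v‖ ≤ q v) (hρhi : 0 ≤ ρhi)
    (hqhi : ∀ v, q v ≤ ρhi * ‖v‖) (x y : Vec d) :
    eLpNorm (fun s => gradient (F s) y - gradient (F s) x) 2 D ≤
      ENNReal.ofReal (ρlo⁻¹ * ((ℒ₀ + ℒ₁ * (ρhi * σ) + ℒ₁ * q (gradient (objective D F) x)) *
        (N (y - x) * Real.exp (ℒ₁ * N (y - x))))) := by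
  have hqc := q.continuous_of_le_norm hρhi hqhi
  have hGm : ∀ v, Measurable fun s => gradient (F s) v :=
    measurable_gradient_param hF fun s => (hd s).differentiable one_ne_zero
  have h1 := eLpNorm_sub_le_of_segmentSup N q hqN hqc D (G := fun s => gradient (F s)) hGm hℒ₁
    hms.eLpNorm_lt_top (hms.eLpNorm_le hqN) x y (fun s =>
      ((continuous_gradient_of_contDiff (hd s)).comp (by fun_prop)).continuousOn)
  have hq0 := apply_nonneg q (gradient (objective D F) x)
  have h2 : eLpNorm (fun s => ENNReal.ofReal ℒ₀ + ENNReal.ofReal ℒ₁ *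
      ENNReal.ofReal (q (gradient (F s) x))) 2 D ≤
      ENNReal.ofReal (ℒ₀ + ℒ₁ * (ρhi * σ) + ℒ₁ * q (gradient (objective D F) x)) := by
    set g := gradient (objective D F) x with hg
    have hle : ∀ s, ‖ENNReal.ofReal ℒ₀ + ENNReal.ofReal ℒ₁ *
        ENNReal.ofReal (q (gradient (F s) x))‖ₑ ≤
        ‖(((fun _ => ℒ₀ + ℒ₁ * q g) : Ξ → ℝ) +
          fun s => ℒ₁ * (q (gradient (F s) x - g))) s‖ₑ := by
      intro s
      have hq1 := apply_nonneg q (gradient (F s) x)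
      have hq2 := apply_nonneg q (gradient (F s) x - g)
      rw [enorm_eq_self, ← ENNReal.ofReal_mul hℒ₁, ← ENNReal.ofReal_add hℒ₀ (by positivity),
        Pi.add_apply, Real.enorm_eq_ofReal (by positivity)]
      refine ENNReal.ofReal_le_ofReal ?_
      have := map_add_le_add q g (gradient (F s) x - g)
      rw [add_sub_cancel] at this
      nlinarith
    refine (eLpNorm_mono_enorm hle).trans ((eLpNorm_add_le aestronglyMeasurable_const
      ((hqc.measurable.comp ((hGm x).sub_const g)).const_mul ℒ₁).aestronglyMeasurable
      (by norm_num)).trans ?_)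
    have e1 : eLpNorm (fun _ : Ξ => ℒ₀ + ℒ₁ * q g) 2 D = ENNReal.ofReal (ℒ₀ + ℒ₁ * q g) := by
      rw [eLpNorm_const _ two_ne_zero (IsProbabilityMeasure.ne_zero D),
        Real.enorm_eq_ofReal (by positivity)]
      simp
    have e2 : eLpNorm (fun s => ℒ₁ * q (gradient (F s) x - g)) 2 D ≤
        ENNReal.ofReal (ℒ₁ * (ρhi * σ)) := by
      have := eLpNorm_const_smul ℒ₁ (fun s => q (gradient (F s) x - g)) 2 D
      rw [← eLpNorm_ofReal_seminorm, Real.enorm_eq_ofReal hℒ₁] at this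
      change eLpNorm (ℒ₁ • fun s => q (gradient (F s) x - g)) 2 D ≤ _
      rw [this, ENNReal.ofReal_mul hℒ₁, ENNReal.ofReal_mul hρhi]
      gcongr
      refine (eLpNorm_seminorm_le q hqhi D _).trans ?_
      gcongr
      exact hvar.eLpNorm_le hσ x
    rw [e1]
    refine (add_le_add_right e2 _).trans ?_
    rw [← ENNReal.ofReal_add (by positivity) (by positivity)]
    exact ENNReal.ofReal_le_ofReal (by linarith)
  refine (eLpNorm_le_seminorm q hρlo hqlo D _).trans ?_
  have hN0 := apply_nonneg N (y - x)
  rw [ENNReal.ofReal_mul (by positivity), ENNReal.ofReal_mul (by positivity)]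
  gcongr
  exact h1.trans (by gcongr)

end Objective

/-! ### Independent samples -/

section Independence

theorem lintegral_comp_of_indep {Ω Ξ T : Type*} {𝒢 mΩ : MeasurableSpace Ω}
    [MeasurableSpace Ξ] [MeasurableSpace T] {P : Measure Ω} [IsProbabilityMeasure P] {D : Measure Ξ}
    [IsProbabilityMeasure D] (h𝒢 : 𝒢 ≤ mΩ) {Z : Ω → T}
    (hZ : Measurable[𝒢] Z) {ξ : Ω → Ξ} (hξ : Measurable ξ) (hlaw : P.map ξ = D)
    (hind : Indep (MeasurableSpace.comap ξ inferInstance) 𝒢 P) {Φ : T × Ξ → ℝ≥0∞}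
    (hΦ : Measurable Φ) :
    ∫⁻ ω, Φ (Z ω, ξ ω) ∂P = ∫⁻ ω, ∫⁻ s, Φ (Z ω, s) ∂D ∂P := by
  have hZm : Measurable Z := hZ.mono h𝒢 le_rfl
  have hif : IndepFun Z ξ P := by
    rw [IndepFun_iff_Indep]
    exact indep_of_indep_of_le_left hind.symm hZ.comap_le
  have hprod := (indepFun_iff_map_prod_eq_prod_map_map hZm.aemeasurable hξ.aemeasurable).1 hif
  have := Measure.isProbabilityMeasure_map (μ := P) hZm.aemeasurable
  rw [← lintegral_map hΦ (hZm.prodMk hξ), hprod, hlaw, lintegral_prod _ hΦ.aemeasurable,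
    lintegral_map hΦ.lintegral_prod_right' hZm]

variable {E : Type*} [NormedAddCommGroup E] [InnerProductSpace ℝ E] [CompleteSpace E]

/-- Orthogonality of a constant and a centred square-integrable vector. -/
theorem lintegral_enorm_const_add_sq {Ξ : Type*} [MeasurableSpace Ξ] {D : Measure Ξ}
    [IsProbabilityMeasure D] {u : Ξ → E} (hu : MemLp u 2 D) (h0 : ∫ s, u s ∂D = 0) (y : E) :
    ∫⁻ s, ‖y + u s‖ₑ ^ 2 ∂D = ‖y‖ₑ ^ 2 + ∫⁻ s, ‖u s‖ₑ ^ 2 ∂D := by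
  have hi : Integrable u D := hu.integrable (by norm_num)
  have hsq : Integrable (fun s => ‖u s‖ ^ 2) D := hu.integrable_norm_pow two_ne_zero
  have hsq' : Integrable (fun s => ‖y + u s‖ ^ 2) D :=
    ((memLp_const y).add hu).integrable_norm_pow two_ne_zero
  rw [lintegral_enorm_sq_eq_ofReal_integral hsq, lintegral_enorm_sq_eq_ofReal_integral hsq',
    ← ofReal_norm, ← ENNReal.ofReal_pow (norm_nonneg _), ← ENNReal.ofReal_add (by positivity)
      (integral_nonneg fun s => by positivity)]
  congr 1
  have hin : Integrable (fun s => 2 * inner ℝ y (u s)) D := (hi.const_inner y).const_mul 2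
  simp_rw [norm_add_sq_real]
  rw [integral_add (f := fun s => ‖y‖ ^ 2 + 2 * inner ℝ y (u s))
    ((integrable_const _).add hin) hsq, integral_add (integrable_const _) hin,
    integral_const_mul, integral_inner hi, h0]
  simp

theorem eLpNorm_sub_integral_le {Ξ : Type*} [MeasurableSpace Ξ] {D : Measure Ξ}
    [IsProbabilityMeasure D] {u : Ξ → E} (hu : MemLp u 2 D) :
    eLpNorm (fun s => u s - ∫ t, u t ∂D) 2 D ≤ eLpNorm u 2 D := by
  refine eLpNorm_two_le_of_sq_le ?_
  rw [eLpNorm_two_sq]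
  have hi : Integrable u D := hu.integrable (by norm_num)
  have := lintegral_enorm_const_add_sq (hu.sub (memLp_const (∫ t, u t ∂D))) (by
    simp only [Pi.sub_apply]
    rw [integral_sub hi (integrable_const _)]
    simp) (∫ t, u t ∂D)
  simp only [Pi.sub_apply, add_sub_cancel] at this
  rw [this]
  exact le_add_self

end Independence

/-! ### Exponentially averaged noise -/

section Average

/-- The exponential average `S_{k+1} = (1 - α) S_k + w_k` of a sequence of random vectors, started
at `S_0 = 0`. -/
noncomputable def expAverage {Ω E : Type*} [AddCommGroup E] [Module ℝ E] (α : ℝ)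
    (w : ℕ → Ω → E) : ℕ → Ω → E
  | 0 => fun _ => 0
  | k + 1 => fun ω => (1 - α) • expAverage α w k ω + w k ω

theorem integrable_and_integral_le_of_lintegral_le {Ω : Type*} [MeasurableSpace Ω] {P : Measure Ω}
    {f : Ω → ℝ} (hf : AEStronglyMeasurable f P) (h0 : ∀ ω, 0 ≤ f ω) {c : ℝ} (hc : 0 ≤ c)
    (h : ∫⁻ ω, ENNReal.ofReal (f ω) ∂P ≤ ENNReal.ofReal c) :
    Integrable f P ∧ ∫ ω, f ω ∂P ≤ c := by
  constructor
  · refine ⟨hf, ?_⟩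
    rw [hasFiniteIntegral_iff_ofReal (Filter.Eventually.of_forall h0)]
    exact h.trans_lt ENNReal.ofReal_lt_top
  · rw [integral_eq_lintegral_of_nonneg_ae (Filter.Eventually.of_forall h0) hf]
    exact ENNReal.toReal_le_of_le_ofReal hc h

variable {Ω Ξ T E : Type*} [MeasurableSpace Ξ] [mΩ : MeasurableSpace Ω] [MeasurableSpace T]
  {P : Measure Ω} [IsProbabilityMeasure P] {D : Measure Ξ} [IsProbabilityMeasure D]
  [NormedAddCommGroup E] [InnerProductSpace ℝ E] [MeasurableSpace E]
  [BorelSpace E] [SecondCountableTopology E]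
  {ℱ : Filtration ℕ mΩ} {ξ : ℕ → Ω → Ξ} {Z : ℕ → Ω → T}

theorem measurable_expAverage (hξ : ∀ k, Measurable[ℱ (k + 1)] (ξ (k + 1)))
    (hZ : ∀ k, Measurable[ℱ k] (Z k)) {u : T × Ξ → E} (hu : Measurable u) (α : ℝ) (k : ℕ) :
    Measurable[ℱ k] (expAverage α (fun j ω => u (Z j ω, ξ (j + 1) ω)) k) := by
  induction k with
  | zero => exact measurable_const
  | succ k ih =>
    have hle : ℱ k ≤ ℱ (k + 1) := ℱ.mono (Nat.le_succ k)
    exact ((ih.mono hle le_rfl).const_smul (1 - α)).add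
      (hu.comp (((hZ k).mono hle le_rfl).prodMk (hξ k)))

variable [CompleteSpace E]

/-- Averaged martingale differences with conditional second moments at most `c²` have second
moment at most `c² / α`: by orthogonality the second moments obey
`V_{k+1} ≤ (1 - α)² V_k + c²`. -/
theorem eLpNorm_expAverage_le (hξ : ∀ k, Measurable[ℱ (k + 1)] (ξ (k + 1)))
    (hlaw : ∀ k, P.map (ξ (k + 1)) = D)
    (hind : ∀ k, Indep (MeasurableSpace.comap (ξ (k + 1)) inferInstance) (ℱ k) P)
    (hZ : ∀ k, Measurable[ℱ k] (Z k)) {u : T × Ξ → E} (hu : Measurable u)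
    (hmean : ∀ k ω, ∫ s, u (Z k ω, s) ∂D = 0) {c : ℝ} (hc : 0 ≤ c)
    (hL2 : ∀ k ω, eLpNorm (fun s => u (Z k ω, s)) 2 D ≤ ENNReal.ofReal c)
    {α : ℝ} (hα : 0 < α) (hα1 : α ≤ 1) (k : ℕ) :
    eLpNorm (expAverage α (fun j ω => u (Z j ω, ξ (j + 1) ω)) k) 2 P ≤
      ENNReal.ofReal (c / √α) := by
  set S := expAverage α (fun j ω => u (Z j ω, ξ (j + 1) ω)) with hS
  have key : ∀ k, ∫⁻ ω, ‖S k ω‖ₑ ^ 2 ∂P ≤ ENNReal.ofReal (c ^ 2 / α) := by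
    intro k
    induction k with
    | zero => simp [hS, expAverage]
    | succ k ih =>
      have hSm := measurable_expAverage hξ hZ hu α k
      have hΦ : Measurable fun p : (E × T) × Ξ => ‖(1 - α) • p.1.1 + u (p.1.2, p.2)‖ₑ ^ 2 :=
        (((measurable_fst.fst.const_smul (1 - α)).add
          (hu.comp (measurable_fst.snd.prodMk measurable_snd))).enorm).pow_const 2
      have h1 := lintegral_comp_of_indep (ℱ.le k) (hSm.prodMk (hZ k))
        ((hξ k).mono (ℱ.le (k + 1)) le_rfl) (hlaw k) (hind k) hΦ
      calc ∫⁻ ω, ‖S (k + 1) ω‖ₑ ^ 2 ∂P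
          = ∫⁻ ω, ∫⁻ s, ‖(1 - α) • S k ω + u (Z k ω, s)‖ₑ ^ 2 ∂D ∂P := h1
        _ ≤ ∫⁻ ω, (ENNReal.ofReal ((1 - α) ^ 2) * ‖S k ω‖ₑ ^ 2 + ENNReal.ofReal (c ^ 2)) ∂P := by
            refine lintegral_mono fun ω => ?_
            have hmem : MemLp (fun s => u (Z k ω, s)) 2 D :=
              ⟨(hu.comp measurable_prodMk_left).aestronglyMeasurable,
                (hL2 k ω).trans_lt ENNReal.ofReal_lt_top⟩
            rw [lintegral_enorm_const_add_sq hmem (hmean k ω), ← eLpNorm_two_sq, enorm_smul, mul_pow,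
              Real.enorm_eq_ofReal (sub_nonneg.2 hα1), ENNReal.ofReal_pow (sub_nonneg.2 hα1),
              ENNReal.ofReal_pow hc]
            gcongr
            exact hL2 k ω
        _ = ENNReal.ofReal ((1 - α) ^ 2) * ∫⁻ ω, ‖S k ω‖ₑ ^ 2 ∂P + ENNReal.ofReal (c ^ 2) := by
            rw [lintegral_add_right _ measurable_const,
              lintegral_const_mul' _ _ ENNReal.ofReal_ne_top]
            simp
        _ ≤ ENNReal.ofReal ((1 - α) ^ 2) * ENNReal.ofReal (c ^ 2 / α) + ENNReal.ofReal (c ^ 2) := by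
            gcongr
        _ = ENNReal.ofReal ((1 - α) ^ 2 * (c ^ 2 / α) + c ^ 2) := by
            rw [← ENNReal.ofReal_mul (by positivity), ← ENNReal.ofReal_add (by positivity)
              (by positivity)]
        _ ≤ ENNReal.ofReal (c ^ 2 / α) := by
            refine ENNReal.ofReal_le_ofReal ?_
            have h2 : c ^ 2 / α * ((1 - α) ^ 2 + α) ≤ c ^ 2 / α * 1 :=
              mul_le_mul_of_nonneg_left (by nlinarith) (by positivity)
            have h3 : c ^ 2 / α * α = c ^ 2 := by field_simp
            nlinarith
  refine eLpNorm_two_le_of_sq_le ((key k).trans ?_)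
  rw [← ENNReal.ofReal_pow (by positivity), div_pow, Real.sq_sqrt hα.le]

end Average

/-- One step of an averaged sequence with a fresh perturbation `v` and a predictable drift `b`. -/
theorem integrable_and_integral_step_le {Ω Ξ T E : Type*} {𝒢 mΩ : MeasurableSpace Ω}
    [MeasurableSpace Ξ] [MeasurableSpace T] {P : Measure Ω} [IsProbabilityMeasure P]
    {D : Measure Ξ} [IsProbabilityMeasure D] [NormedAddCommGroup E] [NormedSpace ℝ E]
    [MeasurableSpace E] [BorelSpace E] (h𝒢 : 𝒢 ≤ mΩ) {ζ : Ω → Ξ} (hζ : Measurable ζ)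
    (hlaw : P.map ζ = D) (hind : Indep (MeasurableSpace.comap ζ inferInstance) 𝒢 P)
    {q : Seminorm ℝ E} (hq : Continuous q) {Z : Ω → T} (hZ : Measurable[𝒢] Z)
    {v : T × Ξ → E} (hv : Measurable v) {b : T → E} {B : Ω → ℝ} (hB0 : ∀ ω, 0 ≤ B ω)
    (hB : Integrable B P)
    (hle : ∀ ω, ∫⁻ s, ENNReal.ofReal (q (v (Z ω, s))) ∂D + ENNReal.ofReal (q (b (Z ω))) ≤
      ENNReal.ofReal (B ω))
    {α : ℝ} (hα1 : α ≤ 1) {R R' : Ω → E} (hR : Integrable (fun ω => q (R ω)) P)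
    (hR'm : Measurable R')
    (hR' : ∀ ω, R' ω = (1 - α) • R ω + v (Z ω, ζ ω) + b (Z ω)) :
    Integrable (fun ω => q (R' ω)) P ∧
      ∫ ω, q (R' ω) ∂P ≤ (1 - α) * ∫ ω, q (R ω) ∂P + ∫ ω, B ω ∂P := by
  have hα0 := sub_nonneg.2 hα1
  have hI0 : 0 ≤ ∫ ω, q (R ω) ∂P := integral_nonneg fun ω => apply_nonneg q _
  have hB0' : 0 ≤ ∫ ω, B ω ∂P := integral_nonneg hB0
  refine integrable_and_integral_le_of_lintegral_le
    (hq.measurable.comp hR'm).aestronglyMeasurable (fun ω => apply_nonneg q _) (by positivity) ?_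
  have hΦ : Measurable fun p : T × Ξ => ENNReal.ofReal (q (v p)) := q.measurable_ofReal hq hv
  have h1 := lintegral_comp_of_indep h𝒢 hZ hζ hlaw hind hΦ
  have hZm : Measurable Z := hZ.mono h𝒢 le_rfl
  calc ∫⁻ ω, ENNReal.ofReal (q (R' ω)) ∂P
      ≤ ∫⁻ ω, (ENNReal.ofReal ((1 - α) * q (R ω)) + (ENNReal.ofReal (q (v (Z ω, ζ ω))) +
          ENNReal.ofReal (q (b (Z ω))))) ∂P := by
        refine lintegral_mono fun ω => ?_
        have t0 := apply_nonneg q (R ω)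
        have t1 := apply_nonneg q (v (Z ω, ζ ω))
        have t2 := apply_nonneg q (b (Z ω))
        rw [← ENNReal.ofReal_add t1 t2, ← ENNReal.ofReal_add (by positivity) (by positivity)]
        refine ENNReal.ofReal_le_ofReal ?_
        rw [hR' ω]
        have t3 := map_add_le_add q ((1 - α) • R ω + v (Z ω, ζ ω)) (b (Z ω))
        have t4 := map_add_le_add q ((1 - α) • R ω) (v (Z ω, ζ ω))
        rw [map_smul_eq_mul, Real.norm_of_nonneg hα0] at t4
        linarith
    _ = ∫⁻ ω, ENNReal.ofReal ((1 - α) * q (R ω)) ∂P + (∫⁻ ω, ENNReal.ofReal (q (v (Z ω, ζ ω))) ∂P +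
          ∫⁻ ω, ENNReal.ofReal (q (b (Z ω))) ∂P) := by
        rw [lintegral_add_left' (hR.aestronglyMeasurable.aemeasurable.const_mul _).ennreal_ofReal,
          lintegral_add_left (f := fun ω => ENNReal.ofReal (q (v (Z ω, ζ ω))))
            (hΦ.comp (hZm.prodMk hζ))]
    _ = ENNReal.ofReal ((1 - α) * ∫ ω, q (R ω) ∂P) + ∫⁻ ω, (∫⁻ s, ENNReal.ofReal (q (v (Z ω, s))) ∂D
          + ENNReal.ofReal (q (b (Z ω)))) ∂P := by
        rw [h1, lintegral_add_left (f := fun ω => ∫⁻ s, ENNReal.ofReal (q (v (Z ω, s))) ∂D)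
            (hΦ.lintegral_prod_right'.comp hZm), ← integral_const_mul,
          ofReal_integral_eq_lintegral_ofReal (hR.const_mul _)
            (Filter.Eventually.of_forall fun ω => mul_nonneg hα0 (apply_nonneg q _))]
    _ ≤ ENNReal.ofReal ((1 - α) * ∫ ω, q (R ω) ∂P) + ∫⁻ ω, ENNReal.ofReal (B ω) ∂P := by
        gcongr with ω
        exact hle ω
    _ = ENNReal.ofReal ((1 - α) * ∫ ω, q (R ω) ∂P + ∫ ω, B ω ∂P) := by
        rw [← ofReal_integral_eq_lintegral_ofReal hB (Filter.Eventually.of_forall hB0),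
          ← ENNReal.ofReal_add (by positivity) hB0']

/-- Summing `r_{k+1} ≤ (1 - α) r_k + b_k` loses a factor `1 / α`. -/
theorem sum_le_of_contraction {α : ℝ} (hα : 0 < α) {r b : ℕ → ℝ}
    (hr : ∀ k, 0 ≤ r k) (h : ∀ k, r (k + 1) ≤ (1 - α) * r k + b k) (n : ℕ) :
    ∑ k ∈ Finset.range n, r k ≤ (r 0 + ∑ k ∈ Finset.range n, b k) / α := by
  have key : ∀ n, α * ∑ k ∈ Finset.range n, r k + r n ≤ r 0 + ∑ k ∈ Finset.range n, b k := by
    intro n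
    induction n with
    | zero => simp
    | succ n ih =>
      rw [Finset.sum_range_succ, Finset.sum_range_succ]
      linarith [h n]
  rw [le_div_iff₀ hα]
  linarith [key n, hr n]

/-! ### The momentum error -/

section MomentumError

variable {d : ℕ} {Ξ Ω : Type*} [MeasurableSpace Ξ] [mΩ : MeasurableSpace Ω]

theorem lintegral_seminorm_le {q : Seminorm ℝ (Vec d)} {ρ : ℝ} (hρ : 0 ≤ ρ)
    (hq : ∀ v, q v ≤ ρ * ‖v‖) (μ : Measure Ω) [IsProbabilityMeasure μ] {u : Ω → Vec d}
    (hu : Measurable u) :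
    ∫⁻ ω, ENNReal.ofReal (q (u ω)) ∂μ ≤ ENNReal.ofReal ρ * eLpNorm u 2 μ := by
  refine le_trans ?_ (eLpNorm_seminorm_le q hq μ u)
  calc ∫⁻ ω, ENNReal.ofReal (q (u ω)) ∂μ
      = eLpNorm (fun ω => ENNReal.ofReal (q (u ω))) 1 μ := by
        rw [eLpNorm_one_eq_lintegral_enorm]
        simp
    _ ≤ _ := eLpNorm_le_eLpNorm_of_exponent_le (by norm_num)
        (q.measurable_ofReal (q.continuous_of_le_norm hρ hq) hu).aestronglyMeasurable

theorem eLpNorm_smul_le_ofReal {E : Type*} [NormedAddCommGroup E] [NormedSpace ℝ E]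
    {μ : Measure Ξ} {u : Ξ → E} {c b : ℝ} (hc : 0 ≤ c) (h : eLpNorm u 2 μ ≤ ENNReal.ofReal b) :
    eLpNorm (fun s => c • u s) 2 μ ≤ ENNReal.ofReal (c * b) := by
  have := eLpNorm_const_smul c u 2 μ
  change eLpNorm (c • u) 2 μ ≤ _
  rw [this, Real.enorm_eq_ofReal hc, ENNReal.ofReal_mul hc]
  gcongr

set_option maxHeartbeats 400000 in
/-- The error `m_k - g(x_k)` of a variance-reduced momentum estimator of a mean field `g`.

The centred increment `Δ` of step `k` has conditional second mean proportional to
`a + ℓ ‖g(x_k)‖_*`, whose square need not be controlled by first moments. It is therefore cut, with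
the predictable weight `τ = a / (a + ℓ ‖g(x_k)‖_*)`, into `τ Δ`, whose conditional second mean is
bounded by a constant so that averaging gains `√α`, and `(1 - τ) Δ`, which is proportional to
`ℓ ‖g(x_k)‖_*` and is only estimated by the triangle inequality. -/
theorem sum_integral_momentum_error_le {P : Measure Ω} [IsProbabilityMeasure P] {D : Measure Ξ}
    [IsProbabilityMeasure D] {ℱ : Filtration ℕ mΩ} {ξ : ℕ → Ω → Ξ}
    (hξ : ∀ k, Measurable[ℱ (k + 1)] (ξ (k + 1))) (hlaw : ∀ k, P.map (ξ (k + 1)) = D)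
    (hind : ∀ k, Indep (MeasurableSpace.comap (ξ (k + 1)) inferInstance) (ℱ k) P)
    {q : Seminorm ℝ (Vec d)} {ρlo ρhi : ℝ} (hρlo : 0 < ρlo) (hρhi : 0 ≤ ρhi)
    (hq : ∀ v, q v ≤ ρhi * ‖v‖)
    {G : Ξ → Vec d → Vec d} {g : Vec d → Vec d} (hG : Measurable fun p : Vec d × Ξ => G p.2 p.1)
    (hg : Measurable g) (hGint : ∀ v, Integrable (fun s => G s v) D)
    (hmean : ∀ v, ∫ s, G s v ∂D = g v) {σ : ℝ} (hσ : 0 ≤ σ)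
    (hnoise : ∀ v, eLpNorm (fun s => G s v - g v) 2 D ≤ ENNReal.ofReal σ)
    {x m : ℕ → Ω → Vec d} (hx : ∀ k, Measurable[ℱ k] (x k))
    (hx' : ∀ k, Measurable[ℱ k] (x (k + 1))) (hm0 : Measurable[ℱ 0] (m 0))
    {α : ℝ} (hα : 0 < α) (hα1 : α ≤ 1) (atNew : Bool)
    (hm : ∀ k ω, m (k + 1) ω = (1 - α) • (m k ω + (G (ξ (k + 1) ω) (x (k + 1) ω) -
      G (ξ (k + 1) ω) (x k ω))) + α • G (ξ (k + 1) ω) (if atNew then x (k + 1) ω else x k ω))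
    {a l h : ℝ} (ha : 0 ≤ a) (hl : 0 ≤ l) (hh : 0 ≤ h)
    (hinc : ∀ k ω, eLpNorm (fun s => G s (x (k + 1) ω) - G s (x k ω)) 2 D ≤
      ENNReal.ofReal (ρlo⁻¹ * ((a + l * q (g (x k ω))) * h)))
    (hinit : Integrable (fun ω => q (m 0 ω - g (x 0 ω))) P)
    (hgint : ∀ k, Integrable (fun ω => q (g (x k ω))) P) (n : ℕ) :
    (∀ k, Integrable (fun ω => q (m k ω - g (x k ω))) P) ∧
    ∑ k ∈ Finset.range n, ∫ ω, q (m k ω - g (x k ω)) ∂P ≤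
      (∫ ω, q (m 0 ω - g (x 0 ω)) ∂P + ∑ k ∈ Finset.range n,
        ρhi * ρlo⁻¹ * h * (l * ∫ ω, q (g (x k ω)) ∂P + α * a)) / α +
      n * (ρhi * ((α * σ + (1 - α) * (ρlo⁻¹ * (a * h))) / √α)) := by
  have hqc := q.continuous_of_le_norm hρhi hq
  have hα0 : 0 ≤ 1 - α := sub_nonneg.2 hα1
  -- the predictable weight and the pieces of the recursion
  set τ : Vec d → ℝ := fun v => a / (a + l * q (g v)) with hτ
  set w : Vec d × Vec d → Vec d := fun z => if atNew then z.2 else z.1 with hw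
  set δ : (Vec d × Vec d) × Ξ → Vec d := fun p =>
    (G p.2 p.1.2 - G p.2 p.1.1) - (g p.1.2 - g p.1.1) with hδ
  set u : (Vec d × Vec d) × Ξ → Vec d := fun p =>
    α • (G p.2 (w p.1) - g (w p.1)) + ((1 - α) * τ p.1.1) • δ p with hu
  set v : (Vec d × Vec d) × Ξ → Vec d := fun p => ((1 - α) * (1 - τ p.1.1)) • δ p with hv
  set b : Vec d × Vec d → Vec d := fun z => α • (g (w z) - g z.2) with hb
  set Z : ℕ → Ω → Vec d × Vec d := fun k ω => (x k ω, x (k + 1) ω) with hZ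
  have hwm : Measurable w := by
    simp only [hw]
    cases atNew
    · exact measurable_fst
    · exact measurable_snd
  have hqg : Measurable fun v => q (g v) := hqc.measurable.comp hg
  have hτm : Measurable τ := measurable_const.div ((hqg.const_mul l).const_add a)
  have hδm : Measurable δ :=
    ((hG.comp (measurable_fst.snd.prodMk measurable_snd)).sub
      (hG.comp (measurable_fst.fst.prodMk measurable_snd))).sub
      ((hg.comp measurable_fst.snd).sub (hg.comp measurable_fst.fst))
  have hum : Measurable u :=
    (((hG.comp ((hwm.comp measurable_fst).prodMk measurable_snd)).sub
      (hg.comp (hwm.comp measurable_fst))).const_smul α).add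
      (((hτm.comp measurable_fst.fst).const_mul (1 - α)).smul hδm)
  have hvm : Measurable v :=
    (((hτm.comp measurable_fst.fst).const_sub 1).const_mul (1 - α)).smul hδm
  have hZm : ∀ k, Measurable[ℱ k] (Z k) := fun k => (hx k).prodMk (hx' k)
  -- the weight splits the modulus `a + l q(g)` into its two summands
  have hq0 : ∀ y, 0 ≤ q (g y) := fun y => apply_nonneg q _
  have hden : ∀ y, 0 ≤ a + l * q (g y) := fun y => by have := hq0 y; positivity
  have hτ0 : ∀ y, 0 ≤ τ y := fun y => div_nonneg ha (hden y)
  have hτ1 : ∀ y, 0 ≤ 1 - τ y := fun y => sub_nonneg.2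
    (div_le_one_of_le₀ (le_add_of_nonneg_right (mul_nonneg hl (hq0 y))) (hden y))
  have hτa : ∀ y, τ y * (a + l * q (g y)) ≤ a := fun y => by
    rcases eq_or_lt_of_le (hden y) with h0 | h0
    · rw [← h0, mul_zero]
      exact ha
    · exact (div_mul_cancel₀ a h0.ne').le
  have hτl : ∀ y, (1 - τ y) * (a + l * q (g y)) ≤ l * q (g y) := fun y => by
    rcases eq_or_lt_of_le (hden y) with h0 | h0
    · rw [← h0, mul_zero]
      exact mul_nonneg hl (hq0 y)
    · have : τ y * (a + l * q (g y)) = a := div_mul_cancel₀ a h0.ne'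
      rw [sub_mul, this]
      linarith
  -- second means of the pieces
  have hincint : ∀ y y', ∫ s, (G s y' - G s y) ∂D = g y' - g y := fun y y' => by
    rw [integral_sub (hGint y') (hGint y), hmean, hmean]
  have hδ2 : ∀ k ω, eLpNorm (fun s => δ (Z k ω, s)) 2 D ≤
      ENNReal.ofReal (ρlo⁻¹ * ((a + l * q (g (x k ω))) * h)) := fun k ω => by
    have hmem : MemLp (fun s => G s (x (k + 1) ω) - G s (x k ω)) 2 D :=
      ⟨((hGint (x (k + 1) ω)).sub (hGint (x k ω))).aestronglyMeasurable,
        (hinc k ω).trans_lt ENNReal.ofReal_lt_top⟩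
    have := eLpNorm_sub_integral_le hmem
    rw [hincint] at this
    exact this.trans (hinc k ω)
  have hδi : ∀ z, Integrable (fun s => δ (z, s)) D := fun z =>
    ((hGint z.2).sub (hGint z.1)).sub (integrable_const (g z.2 - g z.1))
  have hδ0 : ∀ z, ∫ s, δ (z, s) ∂D = 0 := fun z => by
    simp only [hδ]
    rw [integral_sub (f := fun s => G s z.2 - G s z.1)
      ((hGint z.2).sub (hGint z.1)) (integrable_const (g z.2 - g z.1)), hincint]
    simp
  have hn0 : ∀ y, ∫ s, (G s y - g y) ∂D = 0 := fun y => by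
    rw [integral_sub (hGint y) (integrable_const _), hmean]
    simp
  have hui : ∀ z, Integrable (fun s => α • (G s (w z) - g (w z))) D := fun z =>
    ((hGint (w z)).sub (integrable_const (g (w z)))).smul α
  have hτδi : ∀ z, Integrable (fun s => ((1 - α) * τ z.1) • δ (z, s)) D := fun z =>
    (hδi z).smul ((1 - α) * τ z.1)
  have hu0 : ∀ z, ∫ s, u (z, s) ∂D = 0 := fun z => by
    simp only [hu]
    rw [integral_add (hui z) (hτδi z), integral_smul, integral_smul, hn0, hδ0]
    simp
  have hu2 : ∀ k ω, eLpNorm (fun s => u (Z k ω, s)) 2 D ≤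
      ENNReal.ofReal (α * σ + (1 - α) * (ρlo⁻¹ * (a * h))) := fun k ω => by
    have h1 := eLpNorm_smul_le_ofReal hα.le (hnoise (w (Z k ω)))
    have h2 := eLpNorm_smul_le_ofReal (mul_nonneg hα0 (hτ0 (x k ω))) (hδ2 k ω)
    have h3 : (1 - α) * τ (x k ω) * (ρlo⁻¹ * ((a + l * q (g (x k ω))) * h)) ≤
        (1 - α) * (ρlo⁻¹ * (a * h)) := by
      calc _ = (1 - α) * (ρlo⁻¹ * ((τ (x k ω) * (a + l * q (g (x k ω)))) * h)) := by ring
        _ ≤ _ := by gcongr (1 - α) * (ρlo⁻¹ * (?_ * h)); exact hτa _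
    refine (eLpNorm_add_le (f := fun s => α • (G s (w (Z k ω)) - g (w (Z k ω))))
      (g := fun s => ((1 - α) * τ (x k ω)) • δ (Z k ω, s))
      (hui (Z k ω)).aestronglyMeasurable
      (hτδi (Z k ω)).aestronglyMeasurable (by norm_num)).trans ?_
    rw [ENNReal.ofReal_add (by positivity) (by positivity)]
    exact add_le_add h1 (h2.trans (ENNReal.ofReal_le_ofReal h3))
  have hv1 : ∀ k ω, ∫⁻ s, ENNReal.ofReal (q (v (Z k ω, s))) ∂D ≤
      ENNReal.ofReal (ρhi * ((1 - α) * (ρlo⁻¹ * (l * q (g (x k ω)) * h)))) := fun k ω => by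
    have h2 := eLpNorm_smul_le_ofReal (mul_nonneg hα0 (hτ1 (x k ω))) (hδ2 k ω)
    have h3 : (1 - α) * (1 - τ (x k ω)) * (ρlo⁻¹ * ((a + l * q (g (x k ω))) * h)) ≤
        (1 - α) * (ρlo⁻¹ * (l * q (g (x k ω)) * h)) := by
      calc _ = (1 - α) * (ρlo⁻¹ * (((1 - τ (x k ω)) * (a + l * q (g (x k ω)))) * h)) := by ring
        _ ≤ _ := by gcongr (1 - α) * (ρlo⁻¹ * (?_ * h)); exact hτl _
    refine (lintegral_seminorm_le hρhi hq D (hvm.comp measurable_prodMk_left)).trans ?_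
    rw [ENNReal.ofReal_mul hρhi]
    gcongr
    exact h2.trans (ENNReal.ofReal_le_ofReal h3)
  have hb1 : ∀ k ω, q (b (Z k ω)) ≤
      α * (ρhi * (ρlo⁻¹ * ((a + l * q (g (x k ω))) * h))) := fun k ω => by
    have hd0 := hden (x k ω)
    have h1 : ‖g (x (k + 1) ω) - g (x k ω)‖ ≤ ρlo⁻¹ * ((a + l * q (g (x k ω))) * h) := by
      rw [← ENNReal.ofReal_le_ofReal_iff (by positivity), ofReal_norm, ← hincint]
      refine (enorm_integral_le_lintegral_enorm _).trans (le_trans ?_ (hinc k ω))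
      rw [← eLpNorm_one_eq_lintegral_enorm]
      exact eLpNorm_le_eLpNorm_of_exponent_le (by norm_num)
        ((hGint (x (k + 1) ω)).sub (hGint (x k ω))).aestronglyMeasurable
    have h2 : q (g (w (Z k ω)) - g (x (k + 1) ω)) ≤ q (g (x (k + 1) ω) - g (x k ω)) := by
      simp only [hw, hZ]
      cases atNew
      · simp [map_sub_rev q]
      · simp
    simp only [hb]
    rw [map_smul_eq_mul, Real.norm_of_nonneg hα.le]
    gcongr
    exact h2.trans ((hq _).trans (by gcongr))
  -- the averaged noise and the remaining error
  set S := expAverage α (fun j ω => u (Z j ω, ξ (j + 1) ω)) with hS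
  have hSm : ∀ k, Measurable[ℱ k] (S k) := measurable_expAverage hξ hZm hum α
  have hmm : ∀ k, Measurable[ℱ k] (m k) := by
    intro k
    induction k with
    | zero => exact hm0
    | succ k ih =>
      have hle : ℱ k ≤ ℱ (k + 1) := ℱ.mono (Nat.le_succ k)
      have e1 : Measurable[ℱ (k + 1)] fun ω => G (ξ (k + 1) ω) (x (k + 1) ω) :=
        hG.comp ((hx (k + 1)).prodMk (hξ k))
      have e2 : Measurable[ℱ (k + 1)] fun ω => G (ξ (k + 1) ω) (x k ω) :=
        hG.comp (((hx k).mono hle le_rfl).prodMk (hξ k))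
      have e3 : Measurable[ℱ (k + 1)]
          fun ω => G (ξ (k + 1) ω) (if atNew then x (k + 1) ω else x k ω) := by
        cases atNew
        · exact e2
        · exact e1
      rw [show m (k + 1) = _ from funext (hm k)]
      exact (((ih.mono hle le_rfl).add (e1.sub e2)).const_smul (1 - α)).add (e3.const_smul α)
  set R : ℕ → Ω → Vec d := fun k ω => m k ω - g (x k ω) - S k ω with hR
  have hRm : ∀ k, Measurable (R k) := fun k =>
    (((hmm k).sub (hg.comp (hx k))).sub (hSm k)).mono (ℱ.le k) le_rfl
  have hRrec : ∀ k ω, R (k + 1) ω = (1 - α) • R k ω + v (Z k ω, ξ (k + 1) ω) + b (Z k ω) := by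
    intro k ω
    simp only [hR, hS, expAverage, hm k ω, hu, hv, hb, hδ, hw, hZ]
    generalize (if atNew = true then x (k + 1) ω else x k ω) = y
    module
  set B : ℕ → Ω → ℝ := fun k ω => ρhi * ρlo⁻¹ * h * (l * q (g (x k ω)) + α * a) with hB
  have hB0 : ∀ k ω, 0 ≤ B k ω := fun k ω => by
    have := hq0 (x k ω)
    simp only [hB]
    positivity
  have hBi : ∀ k, Integrable (B k) P := fun k =>
    (((hgint k).const_mul l).add (integrable_const _)).const_mul _
  have hBint : ∀ k, ∫ ω, B k ω ∂P = ρhi * ρlo⁻¹ * h * (l * ∫ ω, q (g (x k ω)) ∂P + α * a) := by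
    intro k
    simp only [hB]
    rw [integral_const_mul, integral_add ((hgint k).const_mul l) (integrable_const _),
      integral_const_mul]
    simp
  have hvb : ∀ k ω, ∫⁻ s, ENNReal.ofReal (q (v (Z k ω, s))) ∂D + ENNReal.ofReal (q (b (Z k ω))) ≤
      ENNReal.ofReal (B k ω) := fun k ω => by
    have hqk := hq0 (x k ω)
    refine (add_le_add (hv1 k ω) (ENNReal.ofReal_le_ofReal (hb1 k ω))).trans ?_
    rw [← ENNReal.ofReal_add (by positivity) (by positivity)]
    refine ENNReal.ofReal_le_ofReal (le_of_eq ?_)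
    simp only [hB]
    ring
  have hstep : ∀ k, Integrable (fun ω => q (R k ω)) P →
      Integrable (fun ω => q (R (k + 1) ω)) P ∧
      ∫ ω, q (R (k + 1) ω) ∂P ≤ (1 - α) * ∫ ω, q (R k ω) ∂P + ∫ ω, B k ω ∂P := fun k hk =>
    integrable_and_integral_step_le (ℱ.le k) ((hξ k).mono (ℱ.le (k + 1)) le_rfl) (hlaw k) (hind k)
      hqc (hZm k) hvm (hB0 k) (hBi k) (hvb k) hα1 hk (hRm (k + 1)) (hRrec k)
  have hR0 : R 0 = fun ω => m 0 ω - g (x 0 ω) := by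
    funext ω
    simp [hR, hS, expAverage]
  have hRi : ∀ k, Integrable (fun ω => q (R k ω)) P := by
    intro k
    induction k with
    | zero => rw [hR0]; exact hinit
    | succ k ih => exact (hstep k ih).1
  set c := α * σ + (1 - α) * (ρlo⁻¹ * (a * h)) with hc
  have hc0 : 0 ≤ c := by positivity
  have hSi : ∀ k, Integrable (fun ω => q (S k ω)) P ∧ ∫ ω, q (S k ω) ∂P ≤ ρhi * (c / √α) := by
    intro k
    have hSk : Measurable (S k) := (hSm k).mono (ℱ.le k) le_rfl
    refine integrable_and_integral_le_of_lintegral_le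
      (hqc.measurable.comp hSk).aestronglyMeasurable (fun ω => apply_nonneg q _) (by positivity) ?_
    refine (lintegral_seminorm_le hρhi hq P hSk).trans ?_
    rw [ENNReal.ofReal_mul hρhi]
    gcongr
    exact eLpNorm_expAverage_le hξ hlaw hind hZm hum (fun k ω => hu0 (Z k ω)) hc0 hu2 hα hα1 k
  have heq : ∀ k ω, m k ω - g (x k ω) = R k ω + S k ω := fun k ω => by simp [hR]
  have hem : ∀ k, AEStronglyMeasurable (fun ω => q (m k ω - g (x k ω))) P := fun k =>
    (hqc.measurable.comp (((hmm k).sub (hg.comp (hx k))).mono (ℱ.le k)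
      le_rfl)).aestronglyMeasurable
  have hele : ∀ k ω, q (m k ω - g (x k ω)) ≤ q (R k ω) + q (S k ω) := fun k ω => by
    rw [heq]
    exact map_add_le_add q _ _
  have hei : ∀ k, Integrable (fun ω => q (m k ω - g (x k ω))) P := fun k =>
    ((hRi k).add (hSi k).1).mono' (hem k) (Filter.Eventually.of_forall fun ω => by
      rw [Real.norm_of_nonneg (apply_nonneg q _)]
      exact hele k ω)
  refine ⟨hei, ?_⟩
  have hsum := sum_le_of_contraction hα (r := fun k => ∫ ω, q (R k ω) ∂P)
    (b := fun k => ∫ ω, B k ω ∂P) (fun k => integral_nonneg fun ω => apply_nonneg q _)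
    (fun k => (hstep k (hRi k)).2) n
  simp only [hBint, hR0] at hsum
  calc ∑ k ∈ Finset.range n, ∫ ω, q (m k ω - g (x k ω)) ∂P
      ≤ ∑ k ∈ Finset.range n, (∫ ω, q (R k ω) ∂P + ρhi * (c / √α)) := by
        refine Finset.sum_le_sum fun k _ => ?_
        refine (integral_mono (hei k) ((hRi k).add (hSi k).1) (hele k)).trans ?_
        simp only [Pi.add_apply]
        rw [integral_add (hRi k) (hSi k).1]
        linarith [(hSi k).2]
    _ = ∑ k ∈ Finset.range n, ∫ ω, q (R k ω) ∂P + n * (ρhi * (c / √α)) := by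
        rw [Finset.sum_add_distrib, Finset.sum_const, Finset.card_range, nsmul_eq_mul]
    _ ≤ _ := by linarith [hsum]

end MomentumError

/-! ### Step sizes and the final balance -/

theorem stepScale_spec {L₁ ℒ₁ ρlo ρhi : ℝ} (hL₁ : 0 ≤ L₁) (hℒ₁ : 0 ≤ ℒ₁)
    (hne : L₁ ≠ 0 ∨ ℒ₁ ≠ 0) (hρlo : 0 < ρlo) (hρhi : 0 < ρhi) :
    0 < stepScale L₁ ℒ₁ ρlo ρhi ∧ L₁ * stepScale L₁ ℒ₁ ρlo ρhi ≤ 1 / 3 ∧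
      ρhi / ρlo * (ℒ₁ * stepScale L₁ ℒ₁ ρlo ρhi) ≤ 1 / 33 := by
  have hκ : 0 < ρhi / ρlo := div_pos hρhi hρlo
  have hB : ℒ₁ ≠ 0 → ρhi / ρlo * (ℒ₁ * (1 / 3 * (1 / (11 * ℒ₁) * (ρhi / ρlo)⁻¹))) = 1 / 33 := by
    intro h
    field_simp
    norm_num
  unfold stepScale
  split_ifs with h1 h2
  · have h2 : ℒ₁ ≠ 0 := hne.resolve_left (not_not.2 h1)
    have hp : 0 < ℒ₁ := lt_of_le_of_ne hℒ₁ h2.symm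
    refine ⟨by positivity, by rw [h1]; norm_num, (hB h2).le⟩
  · have hp : 0 < L₁ := lt_of_le_of_ne hL₁ (Ne.symm h1)
    refine ⟨by positivity, le_of_eq (by field_simp), by rw [h2]; norm_num⟩
  · have hp1 : 0 < L₁ := lt_of_le_of_ne hL₁ (Ne.symm h1)
    have hp2 : 0 < ℒ₁ := lt_of_le_of_ne hℒ₁ (Ne.symm h2)
    refine ⟨by positivity, ?_, ?_⟩
    · calc L₁ * (1 / 3 * min (1 / L₁) (1 / (11 * ℒ₁) * (ρhi / ρlo)⁻¹))
          ≤ L₁ * (1 / 3 * (1 / L₁)) := by gcongr; exact min_le_left _ _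
        _ = 1 / 3 := by field_simp
    · calc ρhi / ρlo * (ℒ₁ * (1 / 3 * min (1 / L₁) (1 / (11 * ℒ₁) * (ρhi / ρlo)⁻¹)))
          ≤ ρhi / ρlo * (ℒ₁ * (1 / 3 * (1 / (11 * ℒ₁) * (ρhi / ρlo)⁻¹))) := by
            gcongr; exact min_le_right _ _
        _ = 1 / 33 := hB h2

/-- One step of the method decreases the objective by `η ‖∇f(x)‖_*`, up to the momentum error and
second-order terms. -/
theorem IsLMO.descent {d : ℕ} {N q : Seminorm ℝ (Vec d)} (hqN : ∀ v, q v = dualNorm N v)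
    (hpair : ∀ u v : Vec d, inner ℝ u v ≤ dualNorm N u * N v) {f : Vec d → ℝ}
    (hf : Differentiable ℝ f) {L₀ L₁ η : ℝ} (hL₀ : 0 ≤ L₀) (hL₁ : 0 ≤ L₁) (hη : 0 < η)
    {m x y : Vec d}
    (hlip : ∀ z, q (gradient f z - gradient f x) ≤
      (L₀ + L₁ * q (gradient f x)) * (N (z - x) * Real.exp (L₁ * N (z - x))))
    (hstep : IsLMO N η m (y - x)) :
    η * ((1 - L₁ * η * Real.exp (L₁ * η) / 2) * q (gradient f x)) ≤
      (f x - f y) + (2 * η * q (m - gradient f x) + L₀ * Real.exp (L₁ * η) / 2 * η ^ 2) := by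
  set g := gradient f x with hg
  have hg0 := apply_nonneg q g
  have he0 := apply_nonneg q (m - g)
  have hr0 := apply_nonneg N (y - x)
  have hc : 0 ≤ L₀ + L₁ * q g := by positivity
  have h1 := le_add_inner_of_gradient_sub_le hpair hf hc hL₁ x y (fun z => by
    rw [← hqN]
    exact hlip z)
  have h2 := hstep.inner_le hη
  have h3 : inner ℝ (g - m) (y - x) ≤ q (m - g) * η := by
    refine (hpair _ _).trans ?_
    rw [← hqN, map_sub_rev q]
    exact mul_le_mul_of_nonneg_left hstep.1 he0
  rw [inner_sub_left] at h3
  have h4 : q g ≤ q m + q (m - g) := by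
    have := map_sub_le_add q m (m - g)
    rwa [sub_sub_cancel] at this
  have h5 : (L₀ + L₁ * q g) / 2 * Real.exp (L₁ * N (y - x)) * N (y - x) ^ 2 ≤
      (L₀ + L₁ * q g) / 2 * Real.exp (L₁ * η) * η ^ 2 := by
    have := hstep.1
    gcongr
  rw [← hqN] at h2
  have h6 := mul_le_mul_of_nonneg_left h4 hη.le
  linarith

/-- The numerical balance, in terms of `s = (K + 1)^{1/3}`: `Γ` is the sum of the expected gradient
norms and `Σe` the sum of the expected momentum errors. -/
theorem average_le_of_descent {s ηh Γ e Δ e₀ L₀ L₁ l κ a ν E₁ E₂ C E₁' : ℝ} (hs : 1 ≤ s)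
    (hηh : 0 < ηh) (hΓ : 0 ≤ Γ) (hL₀ : 0 ≤ L₀) (hκ : 0 ≤ κ)
    (ha : 0 ≤ a) (haC : a ≤ C) (hE₁' : E₁ ≤ E₁')
    (hE₂' : E₂ ≤ 33 / 32)
    (h1 : L₁ * (ηh / s ^ 2) * E₁ ≤ 1 / 2) (h2 : κ * (l * ηh) * E₂ ≤ 1 / 32)
    (hdesc : ηh / s ^ 2 * ((1 - L₁ * (ηh / s ^ 2) * E₁ / 2) * Γ) ≤
      Δ + (2 * (ηh / s ^ 2) * e + s ^ 3 * (L₀ * E₁ / 2 * (ηh / s ^ 2) ^ 2)))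
    (herr : e ≤ (e₀ + κ * (ηh / s ^ 2 * E₂) * (l * Γ + s ^ 3 * (1 / s ^ 2 * a))) / (1 / s ^ 2) +
      s ^ 3 * ((1 / s ^ 2 * ν + (1 - 1 / s ^ 2) * (κ * (a * (ηh / s ^ 2 * E₂)))) / (1 / s))) :
    Γ / s ^ 3 ≤ 2 * Δ / (ηh * s) + 4 * (e₀ + ν) / s + ηh * L₀ * E₁' / s ^ 2 +
      8 * κ * C * (ηh / s) := by
  have hs0 : 0 < s := by linarith
  -- the error budget, cleared of fractions
  have e1 : e ≤ s ^ 2 * e₀ + κ * (l * ηh) * E₂ * Γ + s ^ 2 * ν +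
      κ * a * ηh * E₂ * (s ^ 2 + s - 1) := by
    refine herr.trans (le_of_eq ?_)
    field_simp
    ring
  have e2 : κ * (l * ηh) * E₂ * Γ ≤ 1 / 32 * Γ := mul_le_mul_of_nonneg_right h2 hΓ
  have hη : 0 < ηh / s ^ 2 := by positivity
  have d1 : (1 - L₁ * (ηh / s ^ 2) * E₁ / 2) * Γ ≤
      Δ * s ^ 2 / ηh + (2 * e + s * (L₀ * E₁ / 2 * ηh)) := by
    have := (le_div_iff₀' hη).2 hdesc
    refine this.trans (le_of_eq ?_)
    field_simp
  have d2 : 3 / 4 * Γ ≤ (1 - L₁ * (ηh / s ^ 2) * E₁ / 2) * Γ :=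
    mul_le_mul_of_nonneg_right (by linarith) hΓ
  have e3 : κ * a * ηh * E₂ * (s ^ 2 + s - 1) ≤ κ * C * ηh * (2 * s ^ 2) := by
    -- `s² + s - 1 ≤ 5/4 s²`, and `5/4 · 33/32 ≤ 2`
    have t0 : 0 ≤ s ^ 2 + s - 1 := by nlinarith
    have t1 : s ^ 2 + s - 1 ≤ 5 / 4 * s ^ 2 := by nlinarith [sq_nonneg (s / 2 - 1)]
    have t2 : κ * a * ηh ≤ κ * C * ηh := by gcongr
    have t3 : 0 ≤ κ * a * ηh := by positivity
    have t4 : E₂ * (s ^ 2 + s - 1) ≤ 2 * s ^ 2 := by nlinarith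
    calc κ * a * ηh * E₂ * (s ^ 2 + s - 1) = κ * a * ηh * (E₂ * (s ^ 2 + s - 1)) := by ring
      _ ≤ κ * a * ηh * (2 * s ^ 2) := by gcongr
      _ ≤ κ * C * ηh * (2 * s ^ 2) := by gcongr
  have e4 : s * (L₀ * E₁ / 2 * ηh) ≤ s * (L₀ * E₁' / 2 * ηh) := by gcongr
  have fin : Γ ≤ 2 * (Δ * s ^ 2 / ηh) + 4 * (s ^ 2 * e₀ + s ^ 2 * ν) + s * (L₀ * E₁' * ηh) +
      8 * (κ * C * ηh * s ^ 2) := by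
    linarith
  rw [div_le_iff₀ (by positivity)]
  refine fin.trans (le_of_eq ?_)
  field_simp

/-! ### The convergence rate -/

set_option maxHeartbeats 800000 in
theorem theorem4 {d : ℕ} {Ξ Ω : Type*} [MeasurableSpace Ξ] [mΩ : MeasurableSpace Ω]
    (D : Measure Ξ) [IsProbabilityMeasure D] (P : Measure Ω) [IsProbabilityMeasure P]
    -- an arbitrary norm on `ℝ^d`, and constants comparing its dual norm with the Euclidean norm
    (N : Seminorm ℝ (Vec d)) (hN : ∀ v, N v = 0 → v = 0)
    (ρlo ρhi : ℝ) (hρlo : 0 < ρlo) (hρhi : 0 < ρhi)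
    (hρ : ∀ v : Vec d, ρlo * ‖v‖ ≤ dualNorm N v ∧ dualNorm N v ≤ ρhi * ‖v‖)
    -- the stochastic objective `f(x) = E_ξ[f_ξ(x)]`
    (F : Ξ → Vec d → ℝ) (hF_meas : ∀ v, Measurable (fun s => F s v))
    (hF_diff : ∀ s, ContDiff ℝ 1 (F s)) (hF_int : ∀ v, Integrable (fun s => F s v) D)
    -- the assumptions
    (σ L₀ L₁ ℒ₀ ℒ₁ : ℝ) (hσ : 0 ≤ σ) (hL₀ : 0 ≤ L₀) (hL₁ : 0 ≤ L₁)
    (hℒ₀ : 0 ≤ ℒ₀) (hℒ₁ : 0 ≤ ℒ₁) (hne : L₁ ≠ 0 ∨ ℒ₁ ≠ 0)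
    (hvar : UnbiasedBoundedVariance D F σ)
    (hbdd : BddBelow (Set.range (objective D F)))
    (hsmooth : RelaxedSmooth N L₀ L₁ (objective D F))
    (hms : MeanSquaredRelaxedSmooth D N ℒ₀ ℒ₁ F)
    -- the parameters and the iterates
    (K : ℕ) (α ηhat η : ℝ) (hα : α = 1 / ((K : ℝ) + 1) ^ ((2 : ℝ) / 3))
    (hηhat : ηhat = stepScale L₁ ℒ₁ ρlo ρhi)
    (hη : η = ηhat / ((K : ℝ) + 1) ^ ((2 : ℝ) / 3))
    (atNew : Bool) (x₀ : Vec d) (ℱ : Filtration ℕ mΩ) (ξ : ℕ → Ω → Ξ) (x m : ℕ → Ω → Vec d)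
    (hrun : IsLMOMars P D N F (fun _ => α) (fun _ => 1 - α) (fun _ => η) atNew x₀ ℱ ξ x m) :
    (∀ k ∈ Finset.range (K + 1),
      Integrable (fun ω => dualNorm N (gradient (objective D F) (x k ω))) P) ∧
    (Finset.range (K + 1)).inf' Finset.nonempty_range_add_one
        (fun k => ∫ ω, dualNorm N (gradient (objective D F) (x k ω)) ∂P) ≤
      2 * (objective D F x₀ - ⨅ v, objective D F v) / (ηhat * ((K : ℝ) + 1) ^ ((1 : ℝ) / 3))
      + 4 * ((∫ ω, dualNorm N (m 0 ω - gradient (objective D F) (x 0 ω)) ∂P) + ρhi * σ)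
          / ((K : ℝ) + 1) ^ ((1 : ℝ) / 3)
      + ηhat * L₀ * Real.exp (L₁ * ηhat) / ((K : ℝ) + 1) ^ ((2 : ℝ) / 3)
      + 8 * (ρhi / ρlo) * (ℒ₀ + 2 * ℒ₁ * ρhi * σ) * Real.exp (6 * ℒ₁ ^ 2 * ηhat ^ 2)
          * (ηhat / ((K : ℝ) + 1) ^ ((1 : ℝ) / 3)) := by
  obtain ⟨hη0, hL1η, hℒη⟩ := stepScale_spec hL₁ hℒ₁ hne hρlo hρhi
  rw [← hηhat] at hη0 hL1η hℒη
  set f := objective D F with hf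
  set g := gradient f with hg
  have hb := bddAbove_inner_image hρlo fun v => (hρ v).1
  set q := dualSeminorm N hb with hq
  have hqN : ∀ v, q v = dualNorm N v := fun v => rfl
  have hqlo : ∀ v, ρlo * ‖v‖ ≤ q v := fun v => (hρ v).1
  have hqhi : ∀ v, q v ≤ ρhi * ‖v‖ := fun v => (hρ v).2
  have hqc := q.continuous_of_le_norm hρhi.le hqhi
  have hgm : Measurable g := measurable_gradient f
  simp only [← hqN]
  -- the parameters in terms of `s = (K + 1)^{1/3}`
  set s : ℝ := ((K : ℝ) + 1) ^ ((1 : ℝ) / 3) with hs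
  have hK1 : (1 : ℝ) ≤ (K : ℝ) + 1 := le_add_of_nonneg_left (Nat.cast_nonneg K)
  have hs1 : 1 ≤ s := Real.one_le_rpow hK1 (by norm_num)
  have hs0 : 0 < s := by linarith
  have hs2 : ((K : ℝ) + 1) ^ ((2 : ℝ) / 3) = s ^ 2 := by
    rw [hs, ← Real.rpow_natCast, ← Real.rpow_mul (by linarith)]
    norm_num
  have hs3 : (K : ℝ) + 1 = s ^ 3 := by
    rw [hs, ← Real.rpow_natCast, ← Real.rpow_mul (by linarith)]
    norm_num
  rw [hs2] at hα hη ⊢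
  have hα0 : 0 < α := by rw [hα]; positivity
  have hα1 : α ≤ 1 := by
    rw [hα]
    exact div_le_one_of_le₀ (one_le_pow₀ hs1) (by positivity)
  have hηpos : 0 < η := by rw [hη]; positivity
  have hηle : η ≤ ηhat := by
    rw [hη]
    exact div_le_self hη0.le (one_le_pow₀ hs1)
  -- the iterates
  have hxm : ∀ k, Measurable[ℱ k] (x k) := fun k => by
    cases k with
    | zero => rw [show x 0 = fun _ => x₀ from funext hrun.x_zero]; exact measurable_const
    | succ k => exact (hrun.x_measurable k).mono (ℱ.mono (Nat.le_succ k)) le_rfl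
  have hlip : ∀ y z, q (g z - g y) ≤
      (L₀ + L₁ * q (g y)) * (N (z - y) * Real.exp (L₁ * N (z - y))) :=
    hsmooth.sub_le hL₀ hL₁ hms hvar hqN hρlo hqlo hρhi.le hqhi
  have hdist : ∀ k ω, N (x k ω - x₀) ≤ k * η := fun k ω => by
    induction k with
    | zero => simp [hrun.x_zero]
    | succ k ih =>
      have h1 := map_add_le_add N (x (k + 1) ω - x k ω) (x k ω - x₀)
      rw [sub_add_sub_cancel] at h1
      have h2 := (hrun.x_step k ω).1
      push_cast
      linarith
  -- all gradients along the run are bounded, since the iterates stay in a bounded set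
  have hgint : ∀ k, Integrable (fun ω => q (g (x k ω))) P := fun k => by
    refine Integrable.of_bound ((hqc.measurable.comp (hgm.comp
      ((hxm k).mono (ℱ.le k) le_rfl))).aestronglyMeasurable)
      (q (g x₀) + (L₀ + L₁ * q (g x₀)) * (k * η * Real.exp (L₁ * (k * η))))
      (Filter.Eventually.of_forall fun ω => ?_)
    have h0 := apply_nonneg q (g x₀)
    have h1 := map_add_le_add q (g x₀) (g (x k ω) - g x₀)
    rw [add_sub_cancel] at h1
    have h2 : (L₀ + L₁ * q (g x₀)) * (N (x k ω - x₀) * Real.exp (L₁ * N (x k ω - x₀))) ≤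
        (L₀ + L₁ * q (g x₀)) * (k * η * Real.exp (L₁ * (k * η))) := by
      have := hdist k ω
      gcongr
    rw [Real.norm_of_nonneg (apply_nonneg q _)]
    linarith [hlip x₀ (x k ω)]
  refine ⟨fun k _ => hgint k, ?_⟩
  have hΔ : ∀ v, (⨅ v, f v) ≤ f v := fun v => ciInf_le hbdd v
  rcases subsingleton_or_nontrivial (Vec d) with hd | hd
  · -- in dimension zero all norms vanish, and `ρlo ≤ ρhi` may fail
    have hz : ∀ v : Vec d, q v = 0 := fun v => by
      rw [Subsingleton.elim v 0, map_zero]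
    have := sub_nonneg.2 (hΔ x₀)
    simp only [hz, integral_zero, Finset.inf'_const]
    positivity
  have hκ1 : 1 ≤ ρhi / ρlo := by
    obtain ⟨v, hv⟩ := exists_ne (0 : Vec d)
    rw [one_le_div hρlo]
    exact le_of_mul_le_mul_right ((hqlo v).trans (hqhi v)) (norm_pos_iff.2 hv)
  have hκ0 : 0 ≤ ρhi / ρlo := by positivity
  -- the momentum error
  set a := ℒ₀ + ℒ₁ * (ρhi * σ) with ha
  have ha0 : 0 ≤ a := by positivity
  have hm : ∀ k ω, m (k + 1) ω = (1 - α) • (m k ω + (gradient (F (ξ (k + 1) ω)) (x (k + 1) ω) -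
      gradient (F (ξ (k + 1) ω)) (x k ω))) +
      α • gradient (F (ξ (k + 1) ω)) (if atNew then x (k + 1) ω else x k ω) := fun k ω => by
    rw [hrun.m_step k ω]
    -- for `α = 1` the scaling factor is the junk value `0 / 0`, but it is multiplied by zero
    rcases eq_or_ne (1 - α) 0 with h | h
    · simp [h]
    · rw [div_self h, one_smul]
  have hinc : ∀ k ω, eLpNorm (fun s => gradient (F s) (x (k + 1) ω) - gradient (F s) (x k ω)) 2 D ≤
      ENNReal.ofReal (ρlo⁻¹ * ((a + ℒ₁ * q (g (x k ω))) * (η * Real.exp (ℒ₁ * η)))) := by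
    intro k ω
    refine (hms.eLpNorm_increment_le hℒ₀ hℒ₁ hF_meas hF_diff hvar hσ hqN hρlo hqlo hρhi.le hqhi
      (x k ω) (x (k + 1) ω)).trans (ENNReal.ofReal_le_ofReal ?_)
    have h1 := (hrun.x_step k ω).1
    have h2 := apply_nonneg q (g (x k ω))
    have h3 := apply_nonneg N (x (k + 1) ω - x k ω)
    gcongr
  have hinit : Integrable (fun ω => q (m 0 ω - g (x 0 ω))) P := by
    simp only [hrun.x_zero]
    have h1 : Integrable (fun ω => m 0 ω - g x₀) P :=
      hrun.m_zero_integrable.sub (integrable_const _)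
    refine (h1.norm.const_mul ρhi).mono' (hqc.comp_aestronglyMeasurable h1.aestronglyMeasurable)
      (Filter.Eventually.of_forall fun ω => ?_)
    rw [Real.norm_of_nonneg (apply_nonneg q _)]
    exact hqhi _
  obtain ⟨hei, herr⟩ := sum_integral_momentum_error_le hrun.sample_measurable hrun.sample_law
    hrun.sample_indep hρlo hρhi.le hqhi (G := fun s => gradient (F s)) (g := g)
    (measurable_gradient_uncurry hF_meas hF_diff) hgm (fun v => (hvar v).1) (fun v => (hvar v).2.1)
    hσ (hvar.eLpNorm_le hσ) hxm hrun.x_measurable hrun.m_zero_measurable hα0 hα1 atNew hm ha0 hℒ₁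
    (by positivity) hinc hinit hgint (K + 1)
  -- descent, summed along the run and integrated
  have hdesc : ∀ k ω, η * ((1 - L₁ * η * Real.exp (L₁ * η) / 2) * q (g (x k ω))) ≤
      (f (x k ω) - f (x (k + 1) ω)) + (2 * η * q (m k ω - g (x k ω)) +
        L₀ * Real.exp (L₁ * η) / 2 * η ^ 2) := fun k ω =>
    (hrun.x_step k ω).descent hqN (inner_le_dualNorm_mul hb hN) hsmooth.1 hL₀ hL₁ hηpos
      (hlip (x k ω))
  have hsum : ∀ ω, ∑ k ∈ Finset.range (K + 1),
      η * ((1 - L₁ * η * Real.exp (L₁ * η) / 2) * q (g (x k ω))) ≤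
      (f x₀ - ⨅ v, f v) + ∑ k ∈ Finset.range (K + 1), (2 * η * q (m k ω - g (x k ω)) +
        L₀ * Real.exp (L₁ * η) / 2 * η ^ 2) := fun ω => by
    refine (Finset.sum_le_sum fun k _ => hdesc k ω).trans ?_
    rw [Finset.sum_add_distrib, Finset.sum_range_sub', hrun.x_zero]
    have := hΔ (x (K + 1) ω)
    gcongr
  set Γ := ∑ k ∈ Finset.range (K + 1), ∫ ω, q (g (x k ω)) ∂P with hΓ
  set e := ∑ k ∈ Finset.range (K + 1), ∫ ω, q (m k ω - g (x k ω)) ∂P with he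
  have hint : η * ((1 - L₁ * η * Real.exp (L₁ * η) / 2) * Γ) ≤
      (f x₀ - ⨅ v, f v) + (2 * η * e + s ^ 3 * (L₀ * Real.exp (L₁ * η) / 2 * η ^ 2)) := by
    have i1 : ∀ k, Integrable (fun ω =>
        η * ((1 - L₁ * η * Real.exp (L₁ * η) / 2) * q (g (x k ω)))) P :=
      fun k => ((hgint k).const_mul _).const_mul _
    have i2 : ∀ k, Integrable (fun ω => 2 * η * q (m k ω - g (x k ω)) +
        L₀ * Real.exp (L₁ * η) / 2 * η ^ 2) P :=
      fun k => ((hei k).const_mul _).add (integrable_const _)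
    have h1 := integral_mono (integrable_finsetSum _ fun k _ => i1 k)
      ((integrable_const (μ := P) (f x₀ - ⨅ v, f v)).add (integrable_finsetSum _ fun k _ => i2 k))
      hsum
    simp only [Pi.add_apply] at h1
    rw [integral_add (integrable_const _) (integrable_finsetSum _ fun k _ => i2 k),
      integral_finsetSum _ fun k _ => i1 k, integral_finsetSum _ fun k _ => i2 k] at h1
    simp only [integral_const_mul] at h1
    rw [Finset.sum_congr rfl fun k _ => integral_add ((hei k).const_mul (2 * η))
      (integrable_const _)] at h1
    simp only [integral_const_mul, integral_const, Measure.real, measure_univ, ENNReal.toReal_one,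
      one_smul, Finset.sum_add_distrib, ← Finset.mul_sum, Finset.sum_const, Finset.card_range,
      nsmul_eq_mul, Nat.cast_add, Nat.cast_one, hs3] at h1
    rw [hΓ, he]
    linarith
  have hΓ0 : 0 ≤ Γ := Finset.sum_nonneg fun k _ => integral_nonneg fun ω => apply_nonneg q _
  have hmin : (Finset.range (K + 1)).inf' Finset.nonempty_range_add_one
      (fun k => ∫ ω, q (g (x k ω)) ∂P) ≤ Γ / s ^ 3 := by
    rw [le_div_iff₀ (by positivity), ← hs3, hΓ]
    have := Finset.card_nsmul_le_sum (Finset.range (K + 1)) (fun k => ∫ ω, q (g (x k ω)) ∂P)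
      ((Finset.range (K + 1)).inf' Finset.nonempty_range_add_one
        (fun k => ∫ ω, q (g (x k ω)) ∂P)) fun k hk => Finset.inf'_le (fun k => ∫ ω, q (g (x k ω)) ∂P) hk
    rw [Finset.card_range, nsmul_eq_mul] at this
    push_cast at this
    linarith
  refine hmin.trans ?_
  have hsqrt : √α = 1 / s := by
    rw [hα, Real.sqrt_div zero_le_one, Real.sqrt_one, Real.sqrt_sq hs0.le]
  -- the exponential factors are bounded by `exp t ≤ 1 / (1 - t)`
  have hE₁ : Real.exp (L₁ * η) ≤ 3 / 2 := by
    have h1 : L₁ * η ≤ 1 / 3 := (mul_le_mul_of_nonneg_left hηle hL₁).trans hL1η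
    refine (Real.exp_le_exp.2 h1).trans
      ((Real.exp_bound_div_one_sub_of_interval (by norm_num) (by norm_num)).trans (by norm_num))
  have hE₂ : Real.exp (ℒ₁ * η) ≤ 33 / 32 := by
    have h0 : ℒ₁ * η ≤ ℒ₁ * ηhat := mul_le_mul_of_nonneg_left hηle hℒ₁
    have h1 : ℒ₁ * η ≤ 1 / 33 := by
      have : 0 ≤ ℒ₁ * ηhat := by positivity
      nlinarith
    refine (Real.exp_le_exp.2 h1).trans
      ((Real.exp_bound_div_one_sub_of_interval (by norm_num) (by norm_num)).trans (by norm_num))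
  have haC : a ≤ (ℒ₀ + 2 * ℒ₁ * ρhi * σ) * Real.exp (6 * ℒ₁ ^ 2 * ηhat ^ 2) := by
    have h1 : 1 ≤ Real.exp (6 * ℒ₁ ^ 2 * ηhat ^ 2) := Real.one_le_exp (by positivity)
    have h2 : 0 ≤ ℒ₁ * (ρhi * σ) := by positivity
    have h3 : 0 ≤ ℒ₀ + 2 * ℒ₁ * ρhi * σ := by positivity
    have h4 : a ≤ ℒ₀ + 2 * ℒ₁ * ρhi * σ := by
      rw [ha]
      linarith
    exact h4.trans (le_mul_of_one_le_right h3 h1)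
  have hfin := average_le_of_descent (s := s) (ηh := ηhat) (Γ := Γ) (e := e)
    (Δ := f x₀ - ⨅ v, f v) (e₀ := ∫ ω, q (m 0 ω - g (x 0 ω)) ∂P) (L₀ := L₀) (L₁ := L₁)
    (l := ℒ₁) (κ := ρhi / ρlo) (a := a) (ν := ρhi * σ) (E₁ := Real.exp (L₁ * η))
    (E₂ := Real.exp (ℒ₁ * η)) (C := (ℒ₀ + 2 * ℒ₁ * ρhi * σ) * Real.exp (6 * ℒ₁ ^ 2 * ηhat ^ 2))
    (E₁' := Real.exp (L₁ * ηhat)) hs1 hη0 hΓ0 hL₀ hκ0 ha0 haC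
    (Real.exp_le_exp.2 (mul_le_mul_of_nonneg_left hηle hL₁)) hE₂
    (by
      rw [← hη]
      have h1 : L₁ * η ≤ 1 / 3 := (mul_le_mul_of_nonneg_left hηle hL₁).trans hL1η
      calc L₁ * η * Real.exp (L₁ * η) ≤ 1 / 3 * (3 / 2) := by gcongr
        _ = 1 / 2 := by norm_num)
    (by
      calc ρhi / ρlo * (ℒ₁ * ηhat) * Real.exp (ℒ₁ * η) ≤ 1 / 33 * (33 / 32) := by gcongr
        _ = 1 / 32 := by norm_num)
    (by rw [← hη]; exact hint)
    (by
      rw [← hη, ← hα, ← hsqrt]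
      refine herr.trans (le_of_eq ?_)
      rw [← Finset.mul_sum, Finset.sum_add_distrib, ← Finset.mul_sum, Finset.sum_const,
        Finset.card_range, nsmul_eq_mul, ← hΓ]
      push_cast
      rw [hs3]
      ring)
  refine hfin.trans (le_of_eq ?_)
  ring
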